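/- Let $X$ be a connected simple graph of bounded valency (there is a constant $M$ such that every vertex has at most $M$ neighbours), let $\mathrm{OE}$ be its set of oriented edges, write $o(e)$, $t(e)$, $e^{-1}$ for the origin, target and reverse of $e\in\mathrm{OE}$, and let $w:\mathrm{OE}\to(0,\infty)$ be a weight function with $\sum_{e\in\mathrm{OE}}w(e)<\infty$. Fix an arbitrary subset $\mathcal E\subset\mathrm{OE}$. Let $T_{\mathcal E}$ be the bounded operator on $\ell^2(\mathrm{OE})$ given on the natural orthonormal basis by $T_{\mathcal E}e=\sum_{e'}w(e')e'$, where the sum runs over all oriented edges $e'$ with $o(e')=t(e)$, and $e'\neq e^{-1}$ unless $e\in\mathcal E$. A path $(x_0,\dots,x_n)$ in $X$ is called $\mathcal E$-regular if, for $1\le j\le n-1$, $x_{j-1}=x_{j+1}$ implies that the oriented edge $(x_{j-1},x_j)$ belongs to $\mathcal E$. On the set of closed paths of length $n\ge1$ (those with $x_n=x_0$) consider the equivalence relation generated by $(x_0,x_1,\dots,x_n)\sim(x_1,\dots,x_n,x_1)$. An $\mathcal E$-cycle is an equivalence class that consists of $\mathcal E$-regular closed paths only; it is prime if it is not a power of a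 shorter one. For an $\mathcal E$-cycle $p$ represented by $(x_0,\dots,x_n)$ put $l(p)=n$ and $w(p)=w(x_0,x_1)\cdots w(x_{n-1},x_n)$, and define $$Z_{\mathcal E}(u)=\prod_p\left(1-w(p)u^{l(p)}\right)^{-1},$$ the product being extended over all prime $\mathcal E$-cycles $p$. Then $T_{\mathcal E}$ is of trace class. The infinite product $Z_{\mathcal E}(u)$ converges for $|u|$ sufficiently small. The limit function extends to a meromorphic function on $\mathbb C$ without zeros; more precisely, the function $Z_{\mathcal E}(u)^{-1}$ is entire and satisfies $$Z_{\mathcal E}(u)^{-1}=\det(1-uT_{\mathcal E})\qquad(u\in\mathbb C),$$ where $\det(1-T)=\sum_{k=0}^\infty(-1)^k\operatorname{tr}\bigwedge^k(T)$ denotes the Fredholm determinant of a trace class operator $T$. -/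

import Mathlib

/-! ### Trace class operators and Fredholm determinants -/

section Fredholm

variable {H : Type*} [NormedAddCommGroup H] [InnerProductSpace ℂ H] [CompleteSpace H]

/-- A bounded operator `T` on a Hilbert space is of trace class if `|T| = (T* T)^(1/2)` has finite
trace, i.e. `∑ ⟨b i, |T| (b i)⟩ < ∞` for every orthonormal (Hilbert) basis `b`. Up to reindexing,
every Hilbert basis is indexed by a subset of `H`. -/
def IsTraceClass (T : H →L[ℂ] H) : Prop :=
  ∀ (ι : Set H) (b : HilbertBasis ι ℂ H),
    Summable fun i : ι => (inner ℂ (b i) (CFC.abs T (b i))).re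

/-- Given an orthonormal basis `b` and a `k`-element set `S = {i₁, …, i_k}` of indices, the
diagonal matrix coefficient `⟨b_S, (⋀ᵏ T) b_S⟩` of `⋀ᵏ T`, where `b_S = b i₁ ∧ … ∧ b i_k`. Here
the inner product on `⋀ᵏ H` is the usual one, with
`⟨x₁ ∧ … ∧ x_k, y₁ ∧ … ∧ y_k⟩ = det (⟨x_i, y_j⟩)`, so the `b_S` are an orthonormal basis of the
Hilbert space `⋀ᵏ H`. The coefficient does not depend on the enumeration of `S`, as a change
of sign of `b_S` cancels. -/
noncomputable def exteriorPowerCoeff {ι : Type*} (b : HilbertBasis ι ℂ H) (T : H →L[ℂ] H) (k : ℕ)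
    (S : {S : Finset ι // S.card = k}) : ℂ :=
  let v : Fin k → H := fun j => b ((S.1.equivFinOfCardEq S.2).symm j : ι)
  exteriorPower.pairingDual ℂ H k
    (exteriorPower.ιMulti ℂ k fun j => ((innerSL ℂ (v j) : H →L[ℂ] ℂ) : H →ₗ[ℂ] ℂ))
    (exteriorPower.map k (T : H →ₗ[ℂ] H) (exteriorPower.ιMulti ℂ k v))

/-- `tr (⋀ᵏ T) = t`: computed in every orthonormal basis, the trace of `⋀ᵏ T` converges
(absolutely) to `t`. -/
def HasExteriorTrace (T : H →L[ℂ] H) (k : ℕ) (t : ℂ) : Prop :=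
  ∀ (ι : Set H) (b : HilbertBasis ι ℂ H), HasSum (exteriorPowerCoeff b T k) t

/-- `det (1 - T) = d`, where `det (1 - T) = ∑ₖ (-1)ᵏ tr (⋀ᵏ T)` is the Fredholm determinant;
the convergence of all traces and of the series is part of the assertion. -/
def HasFredholmDet (T : H →L[ℂ] H) (d : ℂ) : Prop :=
  ∃ t : ℕ → ℂ, (∀ k, HasExteriorTrace T k (t k)) ∧ HasSum (fun k => (-1) ^ k * t k) d

end Fredholm

/-! ### Weighted graphs -/

/-- A connected graph of bounded valency on the vertex set `V`, with a positive weight on its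
oriented edges (`SimpleGraph.Dart`) such that the total weight is finite. -/
structure WeightedGraph (V : Type*) where
  graph : SimpleGraph V
  connected : graph.Connected
  bounded_valency : ∃ M : ℕ, ∀ x : V, (graph.neighborSet x).encard ≤ M
  weight : graph.Dart → ℝ
  weight_pos : ∀ e, 0 < weight e
  summable_weight : Summable weight

/-- A closed path `(x_0, x_1, …, x_n)`, `x_n = x_0`, of length `n ≥ 1` in a graph. It is recorded
as its length `n` and the `n`-periodic continuation `ℕ → V` of the sequence of its vertices. -/
structure ClosedPath {V : Type*} (G : SimpleGraph V) where
  len : ℕ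
  len_pos : 0 < len
  vert : ℕ → V
  vert_add_len : ∀ i, vert (i + len) = vert i
  adj : ∀ i, G.Adj (vert i) (vert (i + 1))

namespace ClosedPath

variable {V : Type*} {G : SimpleGraph V}

/-- The oriented edge `(x_i, x_{i+1})`. -/
def dart (p : ClosedPath G) (i : ℕ) : G.Dart :=
  ⟨(p.vert i, p.vert (i + 1)), p.adj i⟩

/-- The shifted path `(x_1, x_2, …, x_n, x_1)`. -/
def shift (p : ClosedPath G) : ClosedPath G where
  len := p.len
  len_pos := p.len_pos
  vert i := p.vert (i + 1)
  vert_add_len i := by rw [Nat.add_right_comm]; exact p.vert_add_len (i + 1)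
  adj i := p.adj (i + 1)

/-- The power `p ^ m`: the closed path `p` run through `m` times. -/
def pow (p : ClosedPath G) (m : ℕ+) : ClosedPath G where
  len := m * p.len
  len_pos := Nat.mul_pos m.pos p.len_pos
  vert := p.vert
  vert_add_len i := (Function.Periodic.nat_mul (f := p.vert) (c := p.len) p.vert_add_len m) i
  adj := p.adj

/-- The product of the weights of the edges `(x_0, x_1), …, (x_{n-1}, x_n)`. -/
def weight (w : G.Dart → ℝ) (p : ClosedPath G) : ℝ :=
  ∏ i ∈ Finset.range p.len, w (p.dart i)

/-- A path `(x_0, …, x_n)` is `E`-regular if, for `1 ≤ j ≤ n - 1`, `x_{j-1} = x_{j+1}` implies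
that the oriented edge `(x_{j-1}, x_j)` lies in `E` (below, `i = j - 1`). -/
def IsRegular (E : Set G.Dart) (p : ClosedPath G) : Prop :=
  ∀ i, i + 2 ≤ p.len → p.vert i = p.vert (i + 2) → p.dart i ∈ E

/-- Closed paths up to the equivalence relation generated by `p ∼ shift p`. -/
def Class (G : SimpleGraph V) : Type _ :=
  Quot fun p q : ClosedPath G => q = p.shift

theorem weight_shift (w : G.Dart → ℝ) (p : ClosedPath G) : p.shift.weight w = p.weight w := by
  obtain ⟨n, hn⟩ : ∃ n, p.len = n + 1 := ⟨p.len - 1, (Nat.succ_pred_eq_of_pos p.len_pos).symm⟩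
  have h : p.dart (n + 1) = p.dart 0 := by
    have h0 := p.vert_add_len 0
    have h1 := p.vert_add_len 1
    rw [hn] at h0 h1
    apply SimpleGraph.Dart.ext
    simp only [dart, Prod.mk.injEq]
    exact ⟨by simpa using h0, by simpa [Nat.add_comm, Nat.add_left_comm] using h1⟩
  change ∏ i ∈ Finset.range p.len, w (p.dart (i + 1)) = ∏ i ∈ Finset.range p.len, w (p.dart i)
  rw [hn, Finset.prod_range_succ, h, Finset.prod_range_succ' (fun i => w (p.dart i))]

namespace Class

/-- The class of a closed path. -/
def mk (p : ClosedPath G) : Class G := Quot.mk _ p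

/-- The length of a class of closed paths. -/
def len : Class G → ℕ :=
  Quot.lift ClosedPath.len (by rintro p _ rfl; rfl)

/-- The weight of a class of closed paths. -/
def weight (w : G.Dart → ℝ) : Class G → ℝ :=
  Quot.lift (ClosedPath.weight w) (by rintro p _ rfl; exact (weight_shift w p).symm)

/-- The `m`-th power of a class of closed paths. -/
def pow (c : Class G) (m : ℕ+) : Class G :=
  Quot.map (fun p => p.pow m) (by rintro p _ rfl; rfl) c

/-- An `E`-cycle is an equivalence class of closed paths consisting of `E`-regular paths only. -/
def IsCycle (E : Set G.Dart) (c : Class G) : Prop :=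
  ∀ p : ClosedPath G, mk p = c → p.IsRegular E

/-- A cycle is prime if it is not a power of a shorter one. -/
def IsPrime (E : Set G.Dart) (c : Class G) : Prop :=
  ¬ ∃ (c₀ : Class G) (m : ℕ+), c₀.IsCycle E ∧ c₀.len < c.len ∧ c₀.pow m = c

end Class

end ClosedPath

namespace WeightedGraph

variable {V : Type*} (X : WeightedGraph V)

/-- The prime `E`-cycles of `X`. -/
def PrimeCycle (E : Set X.graph.Dart) : Type _ :=
  {c : ClosedPath.Class X.graph // c.IsCycle E ∧ c.IsPrime E}

/-- The term `w(p) u ^ l(p)` of a prime `E`-cycle `p`. -/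
noncomputable def cycleTerm {E : Set X.graph.Dart} (u : ℂ) (p : X.PrimeCycle E) : ℂ :=
  (p.1.weight X.weight : ℂ) * u ^ p.1.len

/-- The zeta function `Z_E(u) = ∏_p (1 - w(p) u ^ l(p))⁻¹`, a product over all prime `E`-cycles. -/
noncomputable def zeta (E : Set X.graph.Dart) (u : ℂ) : ℂ :=
  ∏' p : X.PrimeCycle E, (1 - X.cycleTerm u p)⁻¹

/-- The Hilbert space `ℓ²(OE)` on the set of oriented edges. -/
abbrev EdgeSpace : Type _ := lp (fun _ : X.graph.Dart => ℂ) 2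

open Classical in
/-- The element of the natural orthonormal basis of `ℓ²(OE)` given by the oriented edge `e`. -/
noncomputable def basisVec (e : X.graph.Dart) : X.EdgeSpace := lp.single 2 e (1 : ℂ)

/-- The oriented edges `e'` such that the origin of `e'` is the target of `e`, and `e' ≠ e⁻¹`
unless `e ∈ E`. -/
def next (E : Set X.graph.Dart) (e : X.graph.Dart) : Set X.graph.Dart :=
  {e' | e'.fst = e.snd ∧ (e' = e.symm → e ∈ E)}

theorem finite_next (E : Set X.graph.Dart) (e : X.graph.Dart) : (X.next E e).Finite := by
  obtain ⟨M, hM⟩ := X.bounded_valency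
  have hfin : (X.graph.neighborSet e.snd).Finite :=
    Set.encard_lt_top_iff.1 (lt_of_le_of_lt (hM _) (ENat.natCast_lt_top M))
  refine Set.Finite.of_finite_image (f := fun e' : X.graph.Dart => e'.snd)
    (hfin.subset ?_) ?_
  · rintro _ ⟨e', he', rfl⟩
    have h := e'.adj
    rw [he'.1] at h
    exact h
  · intro a ha b hb hab
    exact SimpleGraph.Dart.ext _ _ (Prod.ext (ha.1.trans hb.1.symm) hab)

/-- The vector `∑ w(e') e'`, the sum running over the oriented edges `e' ∈ next E e`. -/
noncomputable def transferVec (E : Set X.graph.Dart) (e : X.graph.Dart) : X.EdgeSpace :=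
  ∑ e' ∈ (X.finite_next E e).toFinset, (X.weight e' : ℂ) • X.basisVec e'

theorem norm_basisVec (e : X.graph.Dart) : ‖X.basisVec e‖ = 1 := by
  classical
  rw [basisVec, lp.norm_single (by norm_num)]
  simp

theorem inner_basisVec (e : X.graph.Dart) (v : X.EdgeSpace) :
    inner ℂ (X.basisVec e) v = v e := by
  classical
  rw [basisVec, lp.inner_single_left]
  simp

theorem summable_norm_transferVec (E : Set X.graph.Dart) :
    Summable fun e => ‖X.transferVec E e‖ := by
  classical
  obtain ⟨M, hM⟩ := X.bounded_valency
  have hbound : ∀ e, ‖X.transferVec E e‖ ≤ ∑ e' ∈ (X.finite_next E e).toFinset, X.weight e' := by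
    intro e
    refine (norm_sum_le _ _).trans (Finset.sum_le_sum fun e' _ => ?_)
    rw [norm_smul, norm_basisVec, mul_one, Complex.norm_real, Real.norm_eq_abs,
      abs_of_pos (X.weight_pos e')]
  have hcard : ∀ (F : Finset X.graph.Dart) (e' : X.graph.Dart),
      ((F.filter fun e => e' ∈ X.next E e).card : ℝ) ≤ M := by
    intro F e'
    have hfin : (X.graph.neighborSet e'.fst).Finite :=
      Set.encard_lt_top_iff.1 (lt_of_le_of_lt (hM _) (ENat.natCast_lt_top M))
    have h1 : (F.filter fun e => e' ∈ X.next E e).card ≤ hfin.toFinset.card := by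
      refine Finset.card_le_card_of_injOn (fun e => e.fst) ?_ ?_
      · intro e he
        have he := (Finset.mem_filter.1 he).2
        have h := e.adj.symm
        rw [← he.1] at h
        simpa using h
      · intro a ha b hb hab
        have ha := (Finset.mem_filter.1 ha).2
        have hb := (Finset.mem_filter.1 hb).2
        exact SimpleGraph.Dart.ext _ _ (Prod.ext hab (ha.1.symm.trans hb.1))
    have h2 := hM e'.fst
    rw [hfin.encard_eq_coe_toFinset_card] at h2
    exact_mod_cast h1.trans (by exact_mod_cast h2)
  refine summable_of_sum_le (c := M * ∑' e, X.weight e) (fun e => norm_nonneg _) fun F => ?_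
  set G := F.biUnion fun e => (X.finite_next E e).toFinset with hG
  calc ∑ e ∈ F, ‖X.transferVec E e‖
      ≤ ∑ e ∈ F, ∑ e' ∈ (X.finite_next E e).toFinset, X.weight e' :=
        Finset.sum_le_sum fun e _ => hbound e
    _ = ∑ e ∈ F, ∑ e' ∈ G, if e' ∈ X.next E e then X.weight e' else 0 := by
        refine Finset.sum_congr rfl fun e he => ?_
        rw [← Finset.sum_filter]
        refine Finset.sum_congr ?_ fun _ _ => rfl
        ext e'
        simp only [Set.Finite.mem_toFinset, Finset.mem_filter, hG, Finset.mem_biUnion]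
        exact ⟨fun h => ⟨⟨e, he, h⟩, h⟩, fun h => h.2⟩
    _ = ∑ e' ∈ G, ((F.filter fun e => e' ∈ X.next E e).card : ℝ) * X.weight e' := by
        rw [Finset.sum_comm]
        refine Finset.sum_congr rfl fun e' _ => ?_
        rw [← Finset.sum_filter, Finset.sum_const, nsmul_eq_mul]
    _ ≤ ∑ e' ∈ G, (M : ℝ) * X.weight e' :=
        Finset.sum_le_sum fun e' _ => mul_le_mul_of_nonneg_right (hcard F e') (X.weight_pos e').le
    _ = M * ∑ e' ∈ G, X.weight e' := by rw [Finset.mul_sum]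
    _ ≤ M * ∑' e, X.weight e :=
        mul_le_mul_of_nonneg_left
          (X.summable_weight.sum_le_tsum G fun e _ => (X.weight_pos e).le) (Nat.cast_nonneg M)

/-- The operator `T_E` on `ℓ²(OE)` with `T_E e = ∑_{e' ∈ next E e} w(e') e'`, as the (absolutely
convergent) sum over `e` of the operators `v ↦ ⟨e, v⟩ T_E e`; see `transferOp_basisVec`. -/
noncomputable def transferOp (E : Set X.graph.Dart) : X.EdgeSpace →L[ℂ] X.EdgeSpace :=
  ∑' e, (innerSL ℂ (X.basisVec e)).smulRight (X.transferVec E e)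

theorem summable_transferOp (E : Set X.graph.Dart) :
    Summable fun e => (innerSL ℂ (X.basisVec e)).smulRight (X.transferVec E e) := by
  refine Summable.of_norm ?_
  refine (X.summable_norm_transferVec E).congr fun e => ?_
  rw [ContinuousLinearMap.norm_smulRight_apply, innerSL_apply_norm, norm_basisVec, one_mul]

/-- `T_E` acts on the natural orthonormal basis as it should. -/
theorem transferOp_basisVec (E : Set X.graph.Dart) (e : X.graph.Dart) :
    X.transferOp E (X.basisVec e) =
      ∑ e' ∈ (X.finite_next E e).toFinset, (X.weight e' : ℂ) • X.basisVec e' := by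
  have h := (ContinuousLinearMap.apply ℂ X.EdgeSpace (X.basisVec e)).hasSum
    (X.summable_transferOp E).hasSum
  change HasSum (fun e₁ => inner ℂ (X.basisVec e₁) (X.basisVec e) • X.transferVec E e₁)
    (X.transferOp E (X.basisVec e)) at h
  refine h.unique ?_
  have h2 := hasSum_single (f := fun e₁ => inner ℂ (X.basisVec e₁) (X.basisVec e) •
    X.transferVec E e₁) e fun e₁ he => by
      rw [inner_basisVec]
      simp [basisVec, he]
  simpa [inner_basisVec, basisVec, transferVec] using h2

end WeightedGraph

/-! Let `A` be the matrix of the transfer operator in the edge basis. The entry in row `e'` and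
column `e` is `w(e')` if `e'` may follow `e`, and `0` otherwise. By bounded valency only boundedly
many `e` precede a given `e'`, so the absolute row sums of `A` are at most `B(e') = C w(e')`, which
is summable. Everything analytic rests on this bound and on the summability of the norms of the
images of the basis vectors.

The Fredholm determinant is the sum of the signed principal minors of `A`. The minor of `S` is at
most the product of `B` over `S`, so the series converges locally uniformly and is entire in `u`.
Traces of exterior powers do not depend on the Hilbert basis, by an absolutely convergent exchange
of sums (`hasSum_prod_inner_map`). For small `u`, passing to the limit over finite submatrices in
`det (1 - M) = exp (-∑ tr (M ^ k) / k)` gives the same formula for `A` (`fredholmDet_eq_exp`).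

The trace of the `k`-th power sums the weights of all cyclically regular closed paths of length `k`.
Each such path is, in a unique way, a power of a shift of a prime cycle's chosen representative
(`PrimeCycle.bijective_shiftPow`). The `m`-th powers of the `l` shifts of a prime cycle carry the
factor `1 / (m l)` each, hence `1 / m` together, and summing over `m` gives `-log (1 - w(p) u ^ l)`.
Exponentiating yields the Euler product for small `u`; the reciprocal of the entire determinant is
the meromorphic extension. -/

/-! ### Products and exchange of absolutely convergent sums -/

theorem hasSum_fin_pi_prod {F : Type*} [NormedField F] [CompleteSpace F] {ι : Type*} {k : ℕ}
    {f : Fin k → ι → F} {s : Fin k → F} (h : ∀ a, HasSum (f a) (s a))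
    (hn : ∀ a, Summable fun i => ‖f a i‖) :
    HasSum (fun i : Fin k → ι => ∏ a, f a (i a)) (∏ a, s a) ∧
      Summable fun i : Fin k → ι => ‖∏ a, f a (i a)‖ := by
  induction k with
  | zero =>
    simp only [Finset.univ_eq_empty, Finset.prod_empty]
    exact ⟨by simp, Summable.of_finite⟩
  | succ k ih =>
    obtain ⟨ih, ihn⟩ := ih (f := fun a => f a.succ) (s := fun a => s a.succ)
      (fun a => h a.succ) (fun a => hn a.succ)
    have hs := (h 0).mul ih (summable_mul_of_summable_norm (f := f 0)
      (g := fun i : Fin k → ι => ∏ a : Fin k, f a.succ (i a)) (hn 0) ihn)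
    have hs' : Summable fun x : ι × (Fin k → ι) => ‖f 0 x.1 * ∏ a : Fin k, f a.succ (x.2 a)‖ :=
      Summable.mul_norm (f := f 0) (g := fun i : Fin k → ι => ∏ a : Fin k, f a.succ (i a)) (hn 0) ihn
    have hp : ∀ x : ι × (Fin k → ι), ∏ a, f a (Fin.consEquiv (fun _ : Fin (k + 1) => ι) x a) =
        f 0 x.1 * ∏ a : Fin k, f a.succ (x.2 a) := fun x => by
      rw [Fin.prod_univ_succ]
      simp [Fin.consEquiv]
    rw [← (Fin.consEquiv fun _ : Fin (k + 1) => ι).hasSum_iff,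
      ← (Fin.consEquiv fun _ : Fin (k + 1) => ι).summable_iff, Fin.prod_univ_succ]
    exact ⟨by simpa only [Function.comp_def, hp] using hs,
      by simpa only [Function.comp_def, hp] using hs'⟩

theorem summable_prod_of_tsum_norm_le {α β : Type*} {f : α → β → ℂ} {g : α → ℝ}
    (h : ∀ x, Summable fun y => ‖f x y‖) (hg : Summable g) (hfg : ∀ x, ∑' y, ‖f x y‖ ≤ g x) :
    Summable fun x : α × β => f x.1 x.2 := by
  refine Summable.of_norm ?_
  rw [summable_prod_of_nonneg]
  · exact ⟨h, hg.of_nonneg_of_le (fun x => tsum_nonneg fun y => norm_nonneg _) hfg⟩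
  · intro x
    exact norm_nonneg _

theorem hasSum_of_summable_prod {α β : Type*} {f : α → β → ℂ}
    (h : Summable fun x : α × β => f x.1 x.2) {p : α → ℂ} {q : β → ℂ}
    (hp : ∀ x, HasSum (f x) (p x)) (hq : ∀ y, HasSum (fun x => f x y) (q y)) :
    HasSum q (∑' x, p x) := by
  rw [(h.hasSum.prod_fiberwise hp).tsum_eq]
  exact HasSum.prod_fiberwise ((Equiv.prodComm β α).hasSum_iff.2 h.hasSum) hq

/-! ### Trace class and basis independence -/

section HilbertBasis

variable {H : Type*} [NormedAddCommGroup H] [InnerProductSpace ℂ H] {ι κ : Type*}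

/-- Cauchy–Schwarz for the finite sum, followed by Bessel's inequality for each factor. -/
theorem HilbertBasis.sum_norm_inner_mul_inner_le (b : HilbertBasis ι ℂ H) (x y : H)
    (s : Finset ι) : ∑ i ∈ s, ‖inner ℂ (b i) x * inner ℂ y (b i)‖ ≤ ‖x‖ * ‖y‖ := by
  refine abs_le_of_sq_le_sq' ?_ (by positivity) |>.2
  simp only [norm_mul]
  refine (Finset.sum_mul_sq_le_sq_mul_sq _ _ _).trans ?_
  rw [mul_pow]
  simp only [norm_inner_symm y]
  exact mul_le_mul (b.orthonormal.sum_inner_products_le x) (b.orthonormal.sum_inner_products_le y)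
    (by positivity) (by positivity)

theorem HilbertBasis.summable_norm_inner_mul_inner (b : HilbertBasis ι ℂ H) (x y : H) :
    Summable fun i => ‖inner ℂ (b i) x * inner ℂ y (b i)‖ :=
  summable_of_sum_le (fun _ => norm_nonneg _) (b.sum_norm_inner_mul_inner_le x y)

theorem HilbertBasis.tsum_norm_inner_mul_inner_le (b : HilbertBasis ι ℂ H) (x y : H) :
    ∑' i, ‖inner ℂ (b i) x * inner ℂ y (b i)‖ ≤ ‖x‖ * ‖y‖ :=
  (b.summable_norm_inner_mul_inner x y).tsum_le_of_sum_le (b.sum_norm_inner_mul_inner_le x y)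

theorem HilbertBasis.hasSum_inner_map (c : HilbertBasis κ ℂ H) (T : H →L[ℂ] H) (x y : H) :
    HasSum (fun e => inner ℂ x (T (c e)) * inner ℂ (c e) y) (inner ℂ x (T y)) := by
  have h := ((c.hasSum_repr y).mapL T).mapL (innerSL ℂ x)
  convert! h using 1
  ext e
  simp [c.repr_apply_apply, mul_comm]

/-- Since `|T|² = T* T`, both squared norms are the same quadratic form at `x`. This transfers
summability over a basis from `T` to `|T|`. -/
theorem norm_cfcAbs_apply [CompleteSpace H] (T : H →L[ℂ] H) (x : H) : ‖CFC.abs T x‖ = ‖T x‖ := by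
  have h : CFC.abs T * CFC.abs T = star T * T := CFC.abs_mul_abs T
  have hs : star (CFC.abs T) = CFC.abs T := (CFC.abs_nonneg T).isSelfAdjoint.star_eq
  have key : ∀ S : H →L[ℂ] H, ((‖S x‖ ^ 2 : ℝ) : ℂ) = inner ℂ x ((star S * S) x) := by
    intro S
    rw [mul_apply_eq_comp, ContinuousLinearMap.star_eq_adjoint,
      ContinuousLinearMap.adjoint_inner_right, inner_self_eq_norm_sq_to_K]
    simp
  have h1 := key (CFC.abs T)
  rw [hs, h, ← key T] at h1
  have h2 : ‖CFC.abs T x‖ ^ 2 = ‖T x‖ ^ 2 := by exact_mod_cast h1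
  exact (sq_eq_sq₀ (norm_nonneg _) (norm_nonneg _)).1 h2

/-- An operator mapping some Hilbert basis to an absolutely summable family is of trace class. -/
theorem isTraceClass_of_summable_norm [CompleteSpace H] (c : HilbertBasis κ ℂ H) {T : H →L[ℂ] H}
    (hT : Summable fun e => ‖T (c e)‖) : IsTraceClass T := by
  intro ι b
  set P := CFC.abs T with hP
  have hPs : Summable fun e => ‖P (c e)‖ := by simpa only [hP, norm_cfcAbs_apply] using hT
  -- Summed over `b` the absolute values are at most `‖P (c e)‖`, which gives joint summability.
  -- Summed over `c` instead, the family yields the diagonal coefficients of `P` in the basis `b`.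
  have hsum : Summable fun x : κ × ι =>
      inner ℂ (b x.2) (P (c x.1)) * inner ℂ (c x.1) (b x.2) :=
    summable_prod_of_tsum_norm_le (fun e => b.summable_norm_inner_mul_inner (P (c e)) (c e)) hPs
      fun e => (b.tsum_norm_inner_mul_inner_le (P (c e)) (c e)).trans_eq (by
        rw [c.orthonormal.norm_eq_one, mul_one])
  have h2 : Summable fun i => inner ℂ (b i) (P (b i)) := by
    have hsw : Summable fun x : ι × κ =>
        inner ℂ (b x.1) (P (c x.2)) * inner ℂ (c x.2) (b x.1) :=
      (Equiv.prodComm ι κ).summable_iff.2 hsum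
    refine hsw.prod.congr fun i => ?_
    exact (c.hasSum_inner_map P (b i) (b i)).tsum_eq
  exact (Complex.hasSum_re h2.hasSum).summable

/-- The Leibniz terms of the minors of an operator, summed over tuples of basis vectors. -/
theorem hasSum_prod_inner_map (b : HilbertBasis ι ℂ H) (c : HilbertBasis κ ℂ H) {T : H →L[ℂ] H}
    (hT : Summable fun e => ‖T (c e)‖) {k : ℕ} (σ : Equiv.Perm (Fin k)) :
    HasSum (fun i : Fin k → ι => ∏ a, inner ℂ (b (i (σ a))) (T (b (i a))))
      (∑' e : Fin k → κ, ∏ a, inner ℂ (c (e (σ a))) (T (c (e a)))) := by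
  -- In this grouping the `a`-th factor involves `i` only through `i a`, so the sum over `i`
  -- factorises. Reindexing the first inner product by `σ` (see `hf`) makes the `a`-th factor depend
  -- on `e` only through `e a`, so the sum over `e` factorises too.
  let f : (Fin k → κ) → Fin k → ι → ℂ := fun e a i =>
    inner ℂ (b i) (T (c (e (σ.symm a)))) * inner ℂ (c (e a)) (b i)
  have hf : ∀ (e : Fin k → κ) (i : Fin k → ι), ∏ a, f e a (i a) =
      ∏ a, (inner ℂ (b (i (σ a))) (T (c (e a))) * inner ℂ (c (e a)) (b (i a))) := by
    intro e i
    simp only [f, Finset.prod_mul_distrib]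
    congr 1
    rw [← Equiv.prod_comp σ]
    simp
  have hpow : Summable fun e : Fin k → κ => ∏ a, ‖T (c (e a))‖ :=
    (hasSum_fin_pi_prod (f := fun _ : Fin k => fun e => ‖T (c e)‖) (fun _ => hT.hasSum)
      (fun _ => by simpa using hT)).1.summable
  have hfa : ∀ e a, Summable fun i => ‖f e a i‖ := fun e a => b.summable_norm_inner_mul_inner _ _
  have hsum : Summable fun x : (Fin k → κ) × (Fin k → ι) => ∏ a, f x.1 a (x.2 a) := by
    have hE : ∀ e, Summable fun i : Fin k → ι => ‖∏ a, f e a (i a)‖ := fun e =>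
      (hasSum_fin_pi_prod (f := f e) (fun a => (hfa e a).of_norm.hasSum) (hfa e)).2
    refine summable_prod_of_tsum_norm_le (f := fun (e : Fin k → κ) (i : Fin k → ι) =>
      ∏ a, f e a (i a)) (g := fun e : Fin k → κ => ∏ a, ‖T (c (e a))‖) hE hpow fun e => ?_
    have h := (hasSum_fin_pi_prod (f := fun a i => ‖f e a i‖) (fun a => (hfa e a).hasSum)
      (fun a => by simpa using hfa e a)).1.tsum_eq
    simp only [norm_prod]
    rw [h, ← Equiv.prod_comp σ.symm fun a => ‖T (c (e a))‖]
    refine Finset.prod_le_prod (fun a _ => tsum_nonneg fun _ => norm_nonneg _) fun a _ => ?_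
    refine (b.tsum_norm_inner_mul_inner_le (T (c (e (σ.symm a)))) (c (e a))).trans_eq ?_
    rw [c.orthonormal.norm_eq_one, mul_one]
  have h1 : ∀ i : Fin k → ι, HasSum (fun e : Fin k → κ => ∏ a, f e a (i a))
      (∏ a, inner ℂ (b (i (σ a))) (T (b (i a)))) := by
    intro i
    simp only [hf]
    refine (hasSum_fin_pi_prod
      (f := fun a e => inner ℂ (b (i (σ a))) (T (c e)) * inner ℂ (c e) (b (i a)))
      (fun a => c.hasSum_inner_map T _ _) fun a => ?_).1
    exact (c.hasSum_inner_map T _ _).summable.norm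
  have h2 : ∀ e : Fin k → κ, HasSum (fun i : Fin k → ι => ∏ a, f e a (i a))
      (∏ a, inner ℂ (c (e (σ a))) (T (c (e a)))) := by
    intro e
    have := (hasSum_fin_pi_prod (f := f e)
      (s := fun a => inner ℂ (c (e a)) (T (c (e (σ.symm a))))) (fun a => ?_) (hfa e)).1
    · rw [← Equiv.prod_comp σ] at this
      simpa using this
    · simpa only [f, mul_comm] using b.hasSum_inner_mul_inner (c (e a)) (T (c (e (σ.symm a))))
  exact hasSum_of_summable_prod (f := fun (e : Fin k → κ) (i : Fin k → ι) => ∏ a, f e a (i a))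
    hsum h2 h1

/-- The trace of `⋀ᵏ T`, up to the factor `k!`, does not depend on the Hilbert basis. -/
theorem hasSum_det_inner_map (b : HilbertBasis ι ℂ H) (c : HilbertBasis κ ℂ H) {T : H →L[ℂ] H}
    (hT : Summable fun e => ‖T (c e)‖) (k : ℕ) :
    HasSum (fun i : Fin k → ι => (Matrix.of fun a a' => inner ℂ (b (i a)) (T (b (i a')))).det)
      (∑ σ : Equiv.Perm (Fin k), Equiv.Perm.sign σ •
        ∑' e : Fin k → κ, ∏ a, inner ℂ (c (e (σ a))) (T (c (e a)))) := by
  simp only [Matrix.det_apply, Matrix.of_apply]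
  exact hasSum_sum fun σ _ => (hasSum_prod_inner_map b c hT σ).const_smul _

end HilbertBasis
/-- If a symmetric function vanishes on the non-injective tuples, its sum over all `k`-tuples is
`k!` times its sum over all `k`-element sets. -/
theorem hasSum_subsets_of_hasSum_tuples {ι : Type*} {k : ℕ} {g : (Fin k → ι) → ℂ} {s : ℂ}
    (h : HasSum g s) (h0 : ∀ i, ¬ Function.Injective i → g i = 0)
    (hg : ∀ i (σ : Equiv.Perm (Fin k)), g (i ∘ σ) = g i)
    {v : {S : Finset ι // S.card = k} → Fin k → ι} (hv : ∀ S, Function.Injective (v S))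
    (hvS : ∀ S, Set.range (v S) = (S.1 : Set ι)) :
    HasSum (fun S => g (v S)) ((k.factorial : ℂ)⁻¹ * s) := by
  classical
  -- An injective tuple is its image `S` together with a permutation relative to the fixed
  -- enumeration `v S`.
  let Φ : {S : Finset ι // S.card = k} × Equiv.Perm (Fin k) →
      {i : Fin k → ι // Function.Injective i} :=
    fun x => ⟨v x.1 ∘ x.2, (hv x.1).comp x.2.injective⟩
  have hrange : ∀ x, Set.range (Φ x).1 = (x.1.1 : Set ι) := fun x => by
    rw [← hvS x.1]
    exact x.2.surjective.range_comp _
  have hΦ : Function.Bijective Φ := by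
    constructor
    · rintro ⟨S, σ⟩ ⟨S', σ'⟩ hx
      have hS : S = S' := by
        have := (hrange (S, σ)).symm.trans ((congrArg (fun y => Set.range y.1) hx).trans
          (hrange (S', σ')))
        exact Subtype.ext (by exact_mod_cast this)
      subst hS
      have : v S ∘ σ = v S ∘ σ' := congrArg Subtype.val hx
      have : σ = σ' := Equiv.ext fun a => hv S (congrFun this a)
      rw [this]
    · rintro ⟨i, hi⟩
      let S : {S : Finset ι // S.card = k} := ⟨Finset.univ.image i, by
        rw [Finset.card_image_of_injective _ hi, Finset.card_univ, Fintype.card_fin]⟩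
      have hmem : ∀ a, ∃ a', v S a' = i a := fun a => by
        have : i a ∈ Set.range (v S) := by
          rw [hvS]
          simp [S]
        exact this
      choose τ hτ using hmem
      have hτi : Function.Injective τ := fun a a' haa => hi (by rw [← hτ, ← hτ, haa])
      refine ⟨(S, Equiv.ofBijective τ (Finite.injective_iff_bijective.1 hτi)), Subtype.ext ?_⟩
      funext a
      exact hτ a
  have h1 : HasSum (fun i : {i : Fin k → ι // Function.Injective i} => g i.1) s := by
    refine (hasSum_subtype_iff_of_support_subset (f := g) (s := {i | Function.Injective i})
      fun i hi => ?_).2 h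
    by_contra hni
    exact hi (h0 i hni)
  have h2 := ((Equiv.ofBijective Φ hΦ).hasSum_iff.2 h1).prod_fiberwise
    (g := fun S => (k.factorial : ℂ) * g (v S)) fun S => by
      have : HasSum (fun _ : Equiv.Perm (Fin k) => g (v S)) ((k.factorial : ℂ) * g (v S)) := by
        convert! hasSum_fintype (fun _ : Equiv.Perm (Fin k) => g (v S)) using 1
        simp [Fintype.card_perm]
      exact this.congr_fun fun σ => hg _ _
  have hk : (k.factorial : ℂ) ≠ 0 := by exact_mod_cast k.factorial_ne_zero
  simpa [hk] using h2.mul_left (k.factorial : ℂ)⁻¹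

/-! ### Exterior traces as sums of principal minors -/

section Fredholm

variable {H : Type*} [NormedAddCommGroup H] [InnerProductSpace ℂ H] {ι κ : Type*}

/-- The matrix of an operator in a Hilbert basis. -/
noncomputable def HilbertBasis.toMatrix (b : HilbertBasis ι ℂ H) (T : H →L[ℂ] H) :
    Matrix ι ι ℂ :=
  Matrix.of fun i j => inner ℂ (b i) (T (b j))

/-- The principal minor of an infinite matrix given by a finite set of indices. -/
noncomputable def Matrix.principalMinor (A : Matrix ι ι ℂ) (S : Finset ι) : ℂ :=
  letI := Classical.decEq ι
  (A.submatrix ((↑) : S → ι) (↑)).det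

theorem Matrix.principalMinor_eq [DecidableEq ι] (A : Matrix ι ι ℂ) (S : Finset ι) :
    A.principalMinor S = (A.submatrix ((↑) : S → ι) (↑)).det := by
  unfold Matrix.principalMinor
  congr!

/-- The determinant of a tuple vanishes when an index repeats and is invariant under permuting the
tuple, so the sum over tuples counts each minor `k!` times. The value is expressed through `c`
alone, so it is the same for every `b`. -/
theorem hasSum_principalMinor (b : HilbertBasis ι ℂ H) (c : HilbertBasis κ ℂ H) {T : H →L[ℂ] H}
    (hT : Summable fun e => ‖T (c e)‖) (k : ℕ) :
    HasSum (fun S : {S : Finset ι // S.card = k} => (b.toMatrix T).principalMinor S)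
      ((k.factorial : ℂ)⁻¹ * ∑ σ : Equiv.Perm (Fin k), Equiv.Perm.sign σ •
        ∑' e : Fin k → κ, ∏ a, inner ℂ (c (e (σ a))) (T (c (e a)))) := by
  classical
  have h := hasSum_subsets_of_hasSum_tuples
    (v := fun S a => ((S.1.equivFinOfCardEq S.2).symm a : ι))
    (hasSum_det_inner_map b c hT k) (fun i hi => ?_) (fun i σ => ?_) (fun S => ?_) fun S => ?_
  · refine h.congr_fun fun S => ?_
    rw [Matrix.principalMinor_eq,
      ← Matrix.det_submatrix_equiv_self (S.1.equivFinOfCardEq S.2).symm]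
    rfl
  · obtain ⟨a, a', h1, h2⟩ : ∃ a a', i a = i a' ∧ a ≠ a' := by
      simpa [Function.Injective] using hi
    exact Matrix.det_zero_of_row_eq h2 (by funext; simp [h1])
  · exact Matrix.det_submatrix_equiv_self σ
      (Matrix.of fun a a' => inner ℂ (b (i a)) (T (b (i a'))))
  · exact Subtype.val_injective.comp (Equiv.injective _)
  · exact ((S.1.equivFinOfCardEq S.2).symm.surjective.range_comp _).trans (by simp)

theorem exteriorPowerCoeff_eq_principalMinor [CompleteSpace H] (b : HilbertBasis ι ℂ H)
    (T : H →L[ℂ] H) (k : ℕ) (S : {S : Finset ι // S.card = k}) :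
    exteriorPowerCoeff b T k S = (b.toMatrix T).principalMinor S := by
  classical
  rw [Matrix.principalMinor_eq,
    ← Matrix.det_submatrix_equiv_self (S.1.equivFinOfCardEq S.2).symm, ← Matrix.det_transpose]
  simp only [exteriorPowerCoeff, exteriorPower.map_apply_ιMulti,
    exteriorPower.pairingDual_ιMulti_ιMulti]
  rfl

/-- The Fredholm determinant is the sum of all signed principal minors in a Hilbert basis mapped
to an absolutely summable family. -/
theorem hasFredholmDet_of_hasSum_principalMinor [CompleteSpace H] (c : HilbertBasis κ ℂ H)
    {T : H →L[ℂ] H} (hT : Summable fun e => ‖T (c e)‖) {d : ℂ}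
    (hd : HasSum (fun S : Finset κ => (-1) ^ S.card * (c.toMatrix T).principalMinor S) d) :
    HasFredholmDet T d := by
  refine ⟨fun k => (k.factorial : ℂ)⁻¹ * ∑ σ : Equiv.Perm (Fin k), Equiv.Perm.sign σ •
    ∑' e : Fin k → κ, ∏ a, inner ℂ (c (e (σ a))) (T (c (e a))), fun k ι b => ?_, ?_⟩
  · exact (hasSum_principalMinor b c hT k).congr_fun (exteriorPowerCoeff_eq_principalMinor b T k)
  · have h1 := (Equiv.sigmaFiberEquiv (Finset.card : Finset κ → ℕ)).hasSum_iff.2 hd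
    refine h1.sigma fun k => ?_
    refine ((hasSum_principalMinor c c hT k).mul_left ((-1) ^ k)).congr_fun ?_
    rintro ⟨S, rfl⟩
    rfl

end Fredholm
-- Determinant and traces of powers of a finite matrix
section FiniteMatrix

open Polynomial

variable {n : Type*} [Fintype n] [DecidableEq n]

/-- Both sides are multiplicative in `p`, so splitting `p` reduces the claim to constants and to
factors `X - a`. For the latter it is the factorisation of the characteristic polynomial at `a`, up
to a sign that agrees because there are as many roots as rows. -/
theorem Matrix.det_aeval {K : Type*} [Field K] [IsAlgClosed K] (M : Matrix n n K) (p : K[X]) :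
    (aeval M p).det = (M.charpoly.roots.map fun x => p.eval x).prod := by
  have hcard : Multiset.card M.charpoly.roots = Fintype.card n := by
    rw [← (IsAlgClosed.splits M.charpoly).natDegree_eq_card_roots, Matrix.charpoly_natDegree_eq_dim]
  have hlin : ∀ a : K, (aeval M (X - C a)).det =
      (M.charpoly.roots.map fun x => (X - C a).eval x).prod := by
    intro a
    have h := (IsAlgClosed.splits M.charpoly).eval_eq_prod_roots_of_monic M.charpoly_monic a
    rw [Matrix.eval_charpoly, ← neg_sub, Matrix.det_neg] at h
    have hneg : (M.charpoly.roots.map fun x => (X - C a).eval x).prod =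
        (-1) ^ Fintype.card n * (M.charpoly.roots.map fun x => a - x).prod := by
      rw [← hcard, ← Multiset.card_map (fun x => a - x), ← Multiset.prod_map_neg]
      simp
    rw [hneg, ← h, ← mul_assoc, ← mul_pow]
    simp [Matrix.algebraMap_eq_diagonal, Matrix.scalar_apply, Pi.algebraMap_def]
  have hprod : ∀ s : Multiset K, (aeval M (s.map fun a => X - C a).prod).det =
      (M.charpoly.roots.map fun x => ((s.map fun a => X - C a).prod).eval x).prod := by
    intro s
    induction s using Multiset.induction with
    | empty => simp
    | cons a s ih =>
      simp only [Multiset.map_cons, Multiset.prod_cons, map_mul, Matrix.det_mul, ih, hlin, eval_mul,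
        Multiset.prod_map_mul]
  conv_lhs => rw [(IsAlgClosed.splits p).eq_prod_roots]
  conv_rhs => rw [(IsAlgClosed.splits p).eq_prod_roots]
  rw [map_mul, Matrix.det_mul, hprod]
  simp only [eval_mul, Multiset.prod_map_mul]
  congr 1
  simp [Matrix.algebraMap_eq_diagonal, Pi.algebraMap_def, hcard]

theorem Matrix.roots_charpoly_pow {K : Type*} [Field K] [IsAlgClosed K] (M : Matrix n n K)
    (k : ℕ) : (M ^ k).charpoly.roots = M.charpoly.roots.map (· ^ k) := by
  have h : (M ^ k).charpoly = ((M.charpoly.roots.map (· ^ k)).map fun a => X - C a).prod := by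
    refine Polynomial.funext fun x => ?_
    -- This choice turns `det_aeval` into the value at `x` of the characteristic polynomial of `M ^
    -- k`.
    have := M.det_aeval (C x - X ^ k)
    rw [Matrix.eval_charpoly, eval_multiset_prod]
    simpa [Matrix.algebraMap_eq_diagonal, Pi.algebraMap_def, Matrix.scalar_apply] using this
  rw [h, roots_multiset_prod_X_sub_C]

theorem Matrix.trace_pow_eq_sum_roots {K : Type*} [Field K] [IsAlgClosed K] (M : Matrix n n K)
    (k : ℕ) : (M ^ k).trace = (M.charpoly.roots.map (· ^ k)).sum := by
  rw [Matrix.trace_eq_sum_roots_charpoly, Matrix.roots_charpoly_pow]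

/-- If `‖z‖ ≥ 1`, then `z - M` is strictly diagonally dominant by rows, hence invertible. -/
theorem Matrix.norm_lt_one_of_mem_roots_charpoly {M : Matrix n n ℂ}
    (hM : ∀ i, ∑ j, ‖M i j‖ < 1) {z : ℂ} (hz : z ∈ M.charpoly.roots) : ‖z‖ < 1 := by
  by_contra! hz1
  have h0 : (Matrix.scalar n z - M).det = 0 := by
    rw [← Matrix.eval_charpoly]
    exact (mem_roots'.1 hz).2
  refine det_ne_zero_of_sum_row_lt_diag (fun i => ?_) h0
  have h1 : ∑ j ∈ Finset.univ.erase i, ‖(Matrix.scalar n z - M) i j‖ =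
      ∑ j ∈ Finset.univ.erase i, ‖M i j‖ := Finset.sum_congr rfl fun j hj => by
    simp [Matrix.scalar_apply, (Finset.ne_of_mem_erase hj).symm]
  have h2 := Finset.add_sum_erase Finset.univ (fun j => ‖M i j‖) (Finset.mem_univ i)
  have h3 : ‖z‖ - ‖M i i‖ ≤ ‖(Matrix.scalar n z - M) i i‖ := by
    simpa [Matrix.scalar_apply] using norm_sub_norm_le z (M i i)
  rw [h1]
  linarith [hM i]

/-- Over the eigenvalues, the determinant is the product of `1 - z` and the traces are power sums,
so the identity is the Taylor series of `-log (1 - z)` added up root by root. -/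
theorem Matrix.det_one_sub_eq_exp {M : Matrix n n ℂ} (hM : ∀ i, ∑ j, ‖M i j‖ < 1) :
    (1 - M).det = Complex.exp (-∑' k : ℕ, (M ^ (k + 1)).trace / (k + 1)) := by
  have hsum : ∀ s : Multiset ℂ, (∀ z ∈ s, ‖z‖ < 1) →
      HasSum (fun k : ℕ => (s.map (· ^ (k + 1))).sum / (k + 1))
        (s.map fun z => -Complex.log (1 - z)).sum ∧
      Complex.exp (-(s.map fun z => -Complex.log (1 - z)).sum) = (s.map fun z => 1 - z).prod := by
    intro s
    induction s using Multiset.induction with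
    | empty =>
      intro _
      simp
    | cons a s ih =>
      intro hs
      obtain ⟨ih1, ih2⟩ := ih fun z hz => hs z (Multiset.mem_cons_of_mem hz)
      have ha := hs a (Multiset.mem_cons_self a s)
      simp only [Multiset.map_cons, Multiset.sum_cons, Multiset.prod_cons, add_div]
      refine ⟨HasSum.add ?_ ih1, ?_⟩
      -- The term of index `0` is a division by zero, hence `0`, and may be dropped.
      · have := Complex.hasSum_taylorSeries_neg_log ha
        rw [← hasSum_nat_add_iff' 1] at this
        simpa using this
      · rw [neg_add, Complex.exp_add, ih2, neg_neg, Complex.exp_log]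
        intro h0
        rw [sub_eq_zero.1 h0 |>.symm] at ha
        simp at ha
  obtain ⟨h1, h2⟩ := hsum M.charpoly.roots fun z hz => Matrix.norm_lt_one_of_mem_roots_charpoly hM hz
  simp only [Matrix.trace_pow_eq_sum_roots, h1.tsum_eq, h2]
  have := (IsAlgClosed.splits M.charpoly).eval_eq_prod_roots_of_monic M.charpoly_monic 1
  rw [← this, Matrix.eval_charpoly, map_one]

theorem Matrix.pow_succ_apply_eq_sum {R : Type*} [CommSemiring R] (M : Matrix n n R) (k : ℕ) :
    ∀ i j, (M ^ (k + 1)) i j = ∑ g : Fin k → n,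
      ∏ t, M ((Fin.cons i g : Fin (k + 1) → n) t) ((Fin.snoc g j : Fin (k + 1) → n) t) := by
  induction k with
  | zero =>
    intro i j
    simp [Fin.snoc]
  | succ k ih =>
    intro i j
    rw [pow_succ', Matrix.mul_apply, ← (Fin.consEquiv fun _ : Fin (k + 1) => n).sum_comp,
      Fintype.sum_prod_type]
    refine Finset.sum_congr rfl fun l _ => ?_
    rw [ih, Finset.mul_sum]
    refine Finset.sum_congr rfl fun g _ => ?_
    have h : (Fin.snoc (Fin.consEquiv (fun _ : Fin (k + 1) => n) (l, g)) j : Fin (k + 2) → n) =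
        Fin.cons l (Fin.snoc g j) := (Fin.cons_snoc_eq_snoc_cons (β := n) l g j).symm
    rw [Fin.prod_univ_succ (n := k + 1), h]
    simp only [Fin.consEquiv_apply, Fin.cons_zero, Fin.cons_succ]

/-- The trace of a power of a matrix is the sum over all cyclic sequences of indices. -/
theorem Matrix.trace_pow_succ_eq_sum {R : Type*} [CommSemiring R] (M : Matrix n n R) (k : ℕ) :
    (M ^ (k + 1)).trace = ∑ f : Fin (k + 1) → n, ∏ t, M (f t) (f (t + 1)) := by
  rw [← (Fin.consEquiv fun _ : Fin (k + 1) => n).sum_comp, Fintype.sum_prod_type]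
  refine Finset.sum_congr rfl fun i _ => ?_
  rw [Matrix.diag_apply, Matrix.pow_succ_apply_eq_sum]
  simp only [Fin.snoc_eq_cons_rotate, Fin.consEquiv_apply, finRotate_apply]

end FiniteMatrix
-- Fredholm determinant of an infinite matrix
section InfiniteMatrix

open Filter Topology

variable {κ : Type*} {A : Matrix κ κ ℂ} {B : κ → ℝ}

/-- The Leibniz sum over permutations is enlarged to all maps `S → S`; the enlarged sum factorises
into a product of row sums. -/
theorem Matrix.norm_principalMinor_le (hA : ∀ a (F : Finset κ), ∑ e ∈ F, ‖A a e‖ ≤ B a)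
    (S : Finset κ) : ‖A.principalMinor S‖ ≤ ∏ a ∈ S, B a := by
  classical
  rw [Matrix.principalMinor_eq, ← Matrix.det_transpose, Matrix.det_apply]
  calc ‖∑ σ : Equiv.Perm S, Equiv.Perm.sign σ •
        ∏ i, (A.submatrix ((↑) : S → κ) (↑)).transpose (σ i) i‖
      ≤ ∑ σ : Equiv.Perm S, ∏ i : S, ‖A i (σ i)‖ := by
        refine (norm_sum_le _ _).trans (Finset.sum_le_sum fun σ _ => ?_)
        rcases Int.units_eq_one_or (Equiv.Perm.sign σ) with h | h <;> simp [h, Units.smul_def]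
    _ = ∑ f ∈ Finset.univ.map
          ⟨fun σ : Equiv.Perm S => (σ : S → S), DFunLike.coe_injective⟩, ∏ i : S, ‖A i (f i)‖ := by
        simp
    _ ≤ ∑ f : S → S, ∏ i : S, ‖A i (f i)‖ :=
        Finset.sum_le_sum_of_subset_of_nonneg (Finset.subset_univ _) fun f _ _ =>
          Finset.prod_nonneg fun i _ => norm_nonneg _
    _ = ∏ i : S, ∑ j : S, ‖A i j‖ := by
        rw [Finset.prod_univ_sum, Fintype.piFinset_univ]
    _ ≤ ∏ i : S, B i := by
        refine Finset.prod_le_prod (fun i _ => Finset.sum_nonneg fun j _ => norm_nonneg _)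
          fun i _ => ?_
        rw [Finset.sum_coe_sort S fun j => ‖A i j‖]
        exact hA i S
    _ = ∏ a ∈ S, B a := Finset.prod_coe_sort S B

theorem norm_le_of_sum_norm_le (hA : ∀ a (F : Finset κ), ∑ e ∈ F, ‖A a e‖ ≤ B a) (a e : κ) :
    ‖A a e‖ ≤ B a := by
  simpa using hA a {e}

theorem nonneg_of_sum_norm_le (hA : ∀ a (F : Finset κ), ∑ e ∈ F, ‖A a e‖ ≤ B a) (a : κ) :
    0 ≤ B a := by
  simpa using hA a ∅

/-- The Fredholm determinant `det (1 - u A)` of an infinite matrix, as a sum of minors. -/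
noncomputable def Matrix.fredholmDet (A : Matrix κ κ ℂ) (u : ℂ) : ℂ :=
  ∑' S : Finset κ, (-u) ^ S.card * A.principalMinor S

theorem norm_fredholmDet_term_le (hA : ∀ a (F : Finset κ), ∑ e ∈ F, ‖A a e‖ ≤ B a)
    {u : ℂ} {R : ℝ} (hu : ‖u‖ ≤ R) (S : Finset κ) :
    ‖(-u) ^ S.card * A.principalMinor S‖ ≤ ∏ a ∈ S, (R * B a) := by
  rw [norm_mul, norm_pow, norm_neg, Finset.prod_mul_distrib, Finset.prod_const]
  exact mul_le_mul (pow_le_pow_left₀ (norm_nonneg _) hu _) (Matrix.norm_principalMinor_le hA S)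
    (norm_nonneg _) (pow_nonneg ((norm_nonneg _).trans hu) _)

theorem summable_prod_finset (hA : ∀ a (F : Finset κ), ∑ e ∈ F, ‖A a e‖ ≤ B a)
    (hB : Summable B) {R : ℝ} (hR : 0 ≤ R) : Summable fun S : Finset κ => ∏ a ∈ S, (R * B a) :=
  summable_finsetProd_of_summable_nonneg
    (fun a => mul_nonneg hR (nonneg_of_sum_norm_le hA a)) (hB.mul_left R)

theorem hasSum_fredholmDet (hA : ∀ a (F : Finset κ), ∑ e ∈ F, ‖A a e‖ ≤ B a) (hB : Summable B)
    (u : ℂ) :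
    HasSum (fun S : Finset κ => (-u) ^ S.card * A.principalMinor S) (A.fredholmDet u) :=
  (Summable.of_norm_bounded (summable_prod_finset hA hB (norm_nonneg u))
    (norm_fredholmDet_term_le hA le_rfl)).hasSum

theorem differentiable_fredholmDet (hA : ∀ a (F : Finset κ), ∑ e ∈ F, ‖A a e‖ ≤ B a)
    (hB : Summable B) : Differentiable ℂ A.fredholmDet := by
  intro u
  have h : DifferentiableOn ℂ A.fredholmDet (Metric.ball 0 (‖u‖ + 1)) :=
    Complex.differentiableOn_tsum_of_summable_norm
      (summable_prod_finset hA hB (add_nonneg (norm_nonneg u) zero_le_one))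
      (fun S => by fun_prop) Metric.isOpen_ball fun S w hw =>
        norm_fredholmDet_term_le hA (mem_ball_zero_iff.1 hw).le S
  exact h.differentiableAt (Metric.isOpen_ball.mem_nhds (by simp))

theorem fredholmDet_zero (A : Matrix κ κ ℂ) : A.fredholmDet 0 = 1 := by
  rw [Matrix.fredholmDet, tsum_eq_single ∅]
  · classical
    rw [Matrix.principalMinor_eq]
    simp
  · intro S hS
    simp [hS]

theorem Matrix.principalMinor_submatrix_map {ι : Type*} (A : Matrix κ κ ℂ) (f : ι ↪ κ)
    (S : Finset ι) : (A.submatrix f f).principalMinor S = A.principalMinor (S.map f) := by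
  classical
  rw [Matrix.principalMinor_eq, Matrix.principalMinor_eq,
    ← Matrix.det_submatrix_equiv_self (Equiv.ofBijective
      (fun x : S => (⟨f x, Finset.mem_map_of_mem f x.2⟩ : S.map f)) ⟨fun x y h =>
        Subtype.ext (f.injective (congrArg Subtype.val h)), fun y => by
          obtain ⟨x, hx, hxy⟩ := Finset.mem_map.1 y.2
          exact ⟨⟨x, hx⟩, Subtype.ext hxy⟩⟩)]
  rfl

/-- Multilinear expansion in the rows: `S` records the rows taken from `M`, the others coming from
the identity. -/
theorem Matrix.det_one_add_eq_sum_principalMinor {n : Type*} [Fintype n] [DecidableEq n]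
    (M : Matrix n n ℂ) : (1 + M).det = ∑ S : Finset n, M.principalMinor S := by
  rw [add_comm]
  have h := (Matrix.detRowAlternating : (n → ℂ) [⋀^n]→ₗ[ℂ] ℂ).map_add_univ M.row
    (1 : Matrix n n ℂ).row
  have h1 : (M + 1).det = Matrix.detRowAlternating (M.row + (1 : Matrix n n ℂ).row) := rfl
  rw [h1, h]
  refine Finset.sum_congr rfl fun S _ => ?_
  rw [Matrix.principalMinor_eq, ← Matrix.det_piecewise_one_eq_submatrix_det]
  rfl

theorem Matrix.sum_powerset_principalMinor [DecidableEq κ] (A : Matrix κ κ ℂ) (u : ℂ)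
    (F : Finset κ) :
    ∑ S ∈ F.powerset, (-u) ^ S.card * A.principalMinor S =
      (1 - u • A.submatrix ((↑) : F → κ) (↑)).det := by
  rw [sub_eq_add_neg, ← neg_smul, Matrix.det_one_add_eq_sum_principalMinor]
  have h : F.powerset = (Finset.univ : Finset (Finset F)).map
      ⟨fun S => S.map (Function.Embedding.subtype (· ∈ F)), Finset.map_injective _⟩ := by
    ext S
    simp only [Finset.mem_powerset, Finset.mem_map, Finset.mem_univ, true_and,
      Function.Embedding.coeFn_mk]
    constructor
    · intro hS
      refine ⟨S.subtype (· ∈ F), ?_⟩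
      rw [Finset.subtype_map]
      exact Finset.filter_true_of_mem hS
    · rintro ⟨S, rfl⟩ x hx
      obtain ⟨y, -, rfl⟩ := Finset.mem_map.1 hx
      exact y.2
  rw [h, Finset.sum_map]
  refine Finset.sum_congr rfl fun S _ => ?_
  simp only [Function.Embedding.coeFn_mk, Finset.card_map]
  rw [← Matrix.principalMinor_submatrix_map, Matrix.principalMinor_eq, Matrix.principalMinor_eq]
  have := Matrix.det_smul ((A.submatrix ((↑) : F → κ) ((↑) : F → κ)).submatrix ((↑) : S → F)
    ((↑) : S → F)) (-u)
  rw [Fintype.card_coe] at this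
  exact this.symm

/-- The trace of the `(k + 1)`-st power of an infinite matrix. -/
noncomputable def Matrix.cyclicSum (A : Matrix κ κ ℂ) (k : ℕ) : ℂ :=
  ∑' f : Fin (k + 1) → κ, ∏ t, A (f t) (f (t + 1))

theorem norm_cyclic_prod_le (hA : ∀ a (F : Finset κ), ∑ e ∈ F, ‖A a e‖ ≤ B a) {k : ℕ}
    (f : Fin (k + 1) → κ) : ‖∏ t, A (f t) (f (t + 1))‖ ≤ ∏ t, B (f t) := by
  rw [norm_prod]
  exact Finset.prod_le_prod (fun _ _ => norm_nonneg _) fun _ _ => norm_le_of_sum_norm_le hA _ _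

theorem hasSum_prod_tuple (hB : Summable B) (k : ℕ) :
    HasSum (fun f : Fin k → κ => ∏ t, B (f t)) ((∑' a, B a) ^ k) := by
  have := (hasSum_fin_pi_prod (k := k) (f := fun _ => B) (fun _ => hB.hasSum) fun _ => hB.norm).1
  simpa using this

theorem hasSum_cyclicSum (hA : ∀ a (F : Finset κ), ∑ e ∈ F, ‖A a e‖ ≤ B a) (hB : Summable B)
    (k : ℕ) :
    HasSum (fun f : Fin (k + 1) → κ => ∏ t, A (f t) (f (t + 1))) (A.cyclicSum k) :=
  (Summable.of_norm_bounded (hasSum_prod_tuple hB (k + 1)).summable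
    (norm_cyclic_prod_le hA)).hasSum

theorem trace_submatrix_pow_succ [DecidableEq κ] (A : Matrix κ κ ℂ) (F : Finset κ) (k : ℕ) :
    ((A.submatrix ((↑) : F → κ) (↑)) ^ (k + 1)).trace =
      ∑ f ∈ Fintype.piFinset fun _ : Fin (k + 1) => F, ∏ t, A (f t) (f (t + 1)) := by
  rw [Matrix.trace_pow_succ_eq_sum]
  refine Finset.sum_bij (fun f _ t => (f t : κ)) (fun f _ => ?_) (fun f _ g _ h => ?_)
    (fun f hf => ?_) fun f _ => rfl
  · simp
  · funext t
    exact Subtype.ext (congrFun h t)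
  · exact ⟨fun t => ⟨f t, Fintype.mem_piFinset.1 hf t⟩, Finset.mem_univ _, rfl⟩

theorem tendsto_piFinset_atTop [DecidableEq κ] (k : ℕ) :
    Tendsto (fun F : Finset κ => Fintype.piFinset fun _ : Fin k => F) atTop atTop := by
  refine Monotone.tendsto_atTop_atTop (fun F G h => Fintype.piFinset_subset _ _ fun _ => h)
    fun Φ => ⟨Φ.biUnion fun f => Finset.univ.image f, fun f hf => ?_⟩
  rw [Fintype.mem_piFinset]
  intro t
  exact Finset.mem_biUnion.2 ⟨f, hf, Finset.mem_image_of_mem _ (Finset.mem_univ t)⟩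

theorem norm_trace_submatrix_pow_le [DecidableEq κ]
    (hA : ∀ a (F : Finset κ), ∑ e ∈ F, ‖A a e‖ ≤ B a) (hB : Summable B) (F : Finset κ) (k : ℕ) :
    ‖((A.submatrix ((↑) : F → κ) (↑)) ^ (k + 1)).trace‖ ≤ (∑' a, B a) ^ (k + 1) := by
  have h := hasSum_prod_tuple hB (k + 1)
  rw [trace_submatrix_pow_succ, ← h.tsum_eq]
  refine (norm_sum_le_of_le _ fun f _ => norm_cyclic_prod_le hA f).trans ?_
  exact h.summable.sum_le_tsum _ fun f _ =>
    Finset.prod_nonneg fun t _ => nonneg_of_sum_norm_le hA _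

/-- The trace formula for the Fredholm determinant. -/
theorem fredholmDet_eq_exp (hA : ∀ a (F : Finset κ), ∑ e ∈ F, ‖A a e‖ ≤ B a) (hB : Summable B)
    {u : ℂ} (hu : ‖u‖ * ∑' a, B a < 1) :
    A.fredholmDet u = Complex.exp (-∑' k : ℕ, u ^ (k + 1) * A.cyclicSum k / (k + 1)) := by
  classical
  set β := ∑' a, B a with hβ
  have hβ0 : 0 ≤ β := tsum_nonneg (nonneg_of_sum_norm_le hA)
  -- Powersets of finite index sets `F` are cofinal among finite families of finite sets. The
  -- partial sums along them are the finite determinants `det (1 - u A_F)`.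
  have h1 := (hasSum_fredholmDet hA hB u).comp tendsto_finset_powerset_atTop_atTop
  have h2 : ∀ F : Finset κ, ∑ S ∈ F.powerset, (-u) ^ S.card * A.principalMinor S =
      Complex.exp (-∑' k : ℕ,
        u ^ (k + 1) * ((A.submatrix ((↑) : F → κ) (↑)) ^ (k + 1)).trace / (k + 1)) := by
    intro F
    rw [Matrix.sum_powerset_principalMinor, Matrix.det_one_sub_eq_exp]
    · simp only [smul_pow, Matrix.trace_smul, smul_eq_mul]
    · intro i
      refine lt_of_le_of_lt ?_ hu
      simp only [Matrix.smul_apply, Matrix.submatrix_apply, norm_smul, ← Finset.mul_sum]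
      rw [Finset.sum_coe_sort F fun j => ‖A i j‖]
      exact mul_le_mul_of_nonneg_left ((hA i F).trans
        (hB.le_tsum _ fun a _ => nonneg_of_sum_norm_le hA a)) (norm_nonneg u)
  have h3 : Tendsto (fun F : Finset κ => ∑' k : ℕ,
      u ^ (k + 1) * ((A.submatrix ((↑) : F → κ) (↑)) ^ (k + 1)).trace / (k + 1)) atTop
      (𝓝 (∑' k : ℕ, u ^ (k + 1) * A.cyclicSum k / (k + 1))) := by
    -- The traces of all finite submatrices obey the same bound `β ^ (k + 1)`, so one geometric
    -- series dominates uniformly in `F`.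
    have hgeo : Summable fun k : ℕ => (‖u‖ * β) ^ (k + 1) :=
      (summable_nat_add_iff 1).2
        (summable_geometric_of_lt_one (mul_nonneg (norm_nonneg _) hβ0) hu)
    refine tendsto_tsum_of_dominated_convergence hgeo (fun k => ?_)
      (Eventually.of_forall fun F k => ?_)
    · refine ((Tendsto.const_mul _ ?_).div_const _)
      simp only [trace_submatrix_pow_succ]
      exact (hasSum_cyclicSum hA hB k).comp (tendsto_piFinset_atTop (k + 1))
    · rw [norm_div, norm_mul, norm_pow, mul_pow]
      refine (div_le_self (by positivity) ?_).trans (mul_le_mul_of_nonneg_left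
        (norm_trace_submatrix_pow_le hA hB F k) (by positivity))
      have : ‖((k : ℂ) + 1)‖ = k + 1 := by
        rw [← Nat.cast_succ, Complex.norm_natCast, Nat.cast_succ]
      rw [this]
      linarith [Nat.cast_nonneg (α := ℝ) k]
  refine tendsto_nhds_unique h1 ?_
  simp only [Function.comp_def, h2]
  exact (Complex.continuous_exp.tendsto _).comp h3.neg

end InfiniteMatrix
-- Shifts, powers and periods of closed paths
namespace ClosedPath

variable {V : Type*} {G : SimpleGraph V} {E : Set G.Dart}

theorem eq_of_len_eq_of_vert_eq {p q : ClosedPath G} (hl : p.len = q.len)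
    (hv : p.vert = q.vert) : p = q := by
  obtain ⟨n, _, v, _, _⟩ := p
  obtain ⟨n', _, v', _, _⟩ := q
  obtain rfl : n = n' := hl
  obtain rfl : v = v' := hv
  rfl

theorem len_iterate_shift (p : ClosedPath G) (j : ℕ) : (shift^[j] p).len = p.len := by
  induction j generalizing p with
  | zero => rfl
  | succ j ih => exact ih p.shift

theorem vert_iterate_shift (p : ClosedPath G) (j i : ℕ) :
    (shift^[j] p).vert i = p.vert (i + j) := by
  induction j generalizing p with
  | zero => rfl
  | succ j ih => exact ih p.shift

theorem dart_iterate_shift (p : ClosedPath G) (j i : ℕ) :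
    (shift^[j] p).dart i = p.dart (i + j) := by
  induction j generalizing p with
  | zero => rfl
  | succ j ih => exact ih p.shift

theorem vert_add_mul_len (p : ClosedPath G) (i m : ℕ) : p.vert (i + m * p.len) = p.vert i :=
  (Function.Periodic.nat_mul (f := p.vert) (c := p.len) p.vert_add_len m) i

theorem iterate_shift_mul_len (p : ClosedPath G) (m : ℕ) : shift^[m * p.len] p = p :=
  eq_of_len_eq_of_vert_eq (len_iterate_shift _ _) (funext fun i => by
    rw [vert_iterate_shift, vert_add_mul_len])

theorem iterate_shift_mod_len (p : ClosedPath G) (j : ℕ) :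
    shift^[j % p.len] p = shift^[j] p := by
  conv_rhs => rw [← Nat.mod_add_div' j p.len, Function.iterate_add_apply, iterate_shift_mul_len]

theorem dart_add_len (p : ClosedPath G) (i : ℕ) : p.dart (i + p.len) = p.dart i := by
  have h := p.iterate_shift_mul_len 1
  rw [one_mul] at h
  rw [← dart_iterate_shift, h]

theorem dart_mod_len (p : ClosedPath G) (i : ℕ) : p.dart (i % p.len) = p.dart i :=
  Function.Periodic.map_mod_nat p.dart_add_len i

theorem vert_eq_of_dart_eq {p q : ClosedPath G} (h : ∀ i, p.dart i = q.dart i) :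
    p.vert = q.vert :=
  funext fun i => congrArg (fun e => e.fst) (h i)

theorem two_le_len (p : ClosedPath G) : 2 ≤ p.len := by
  by_contra! h
  have h1 : p.len = 1 := by have := p.len_pos; omega
  have h2 := p.vert_add_len 0
  rw [h1] at h2
  exact (p.adj 0).ne h2.symm

theorem weight_iterate_shift (w : G.Dart → ℝ) (p : ClosedPath G) (j : ℕ) :
    (shift^[j] p).weight w = p.weight w := by
  induction j generalizing p with
  | zero => rfl
  | succ j ih => exact (ih p.shift).trans (weight_shift w p)

theorem weight_pow (w : G.Dart → ℝ) (p : ClosedPath G) (m : ℕ+) :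
    (p.pow m).weight w = p.weight w ^ (m : ℕ) := by
  change ∏ i ∈ Finset.range (m * p.len), w (p.dart i) = (∏ i ∈ Finset.range p.len, w (p.dart i)) ^ _
  generalize (m : ℕ) = k
  induction k with
  | zero => simp
  | succ k ih =>
    rw [add_mul, one_mul, Finset.prod_range_add, ih, pow_succ]
    congr 1
    refine Finset.prod_congr rfl fun i _ => ?_
    rw [← dart_mod_len, Nat.mul_add_mod_self_right, dart_mod_len]

theorem mk_iterate_shift (p : ClosedPath G) (j : ℕ) : Class.mk (shift^[j] p) = Class.mk p := by
  induction j generalizing p with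
  | zero => rfl
  | succ j ih => exact (ih p.shift).trans (Quot.sound (r := fun p q : ClosedPath G => q = p.shift) rfl).symm

theorem mk_eq_mk_iff {p q : ClosedPath G} :
    Class.mk p = Class.mk q ↔ ∃ j, shift^[j] p = q := by
  refine ⟨fun h => ?_, ?_⟩
  · have hpq := Quot.eqvGen_exact h
    clear h
    induction hpq with
    | rel p q h => exact ⟨1, h.symm⟩
    | refl p => exact ⟨0, rfl⟩
    | symm p q h ih =>
      obtain ⟨j, rfl⟩ := ih
      -- A shift by `j` is undone by shifting on until `j` full turns are completed.
      refine ⟨j * p.len - j, ?_⟩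
      rw [← Function.iterate_add_apply, Nat.sub_add_cancel (Nat.le_mul_of_pos_right j p.len_pos),
        iterate_shift_mul_len]
    | trans p q r h1 h2 ih1 ih2 =>
      obtain ⟨j, rfl⟩ := ih1
      obtain ⟨j', rfl⟩ := ih2
      exact ⟨j' + j, Function.iterate_add_apply _ _ _ _⟩
  · rintro ⟨j, rfl⟩
    exact (mk_iterate_shift p j).symm

/-- Regularity of a closed path at all its vertices, including its base point. -/
def IsCyclicallyRegular (E : Set G.Dart) (p : ClosedPath G) : Prop :=
  ∀ i, p.vert i = p.vert (i + 2) → p.dart i ∈ E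

/-- Shifting by `i` makes the turn at position `i` the first turn of a path in the class. Regularity
tests that turn because a graph without loops has only closed paths of length at least `2`. -/
theorem isCycle_mk_iff {p : ClosedPath G} :
    (Class.mk p).IsCycle E ↔ p.IsCyclicallyRegular E := by
  constructor
  · intro h i hi
    have := h (shift^[i] p) (mk_iterate_shift p i) 0
      ((len_iterate_shift p i).symm ▸ p.two_le_len)
    rw [vert_iterate_shift, vert_iterate_shift, dart_iterate_shift, zero_add, add_comm] at this
    exact this hi
  · intro h q hq i _ hi
    obtain ⟨j, rfl⟩ := mk_eq_mk_iff.1 hq.symm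
    rw [vert_iterate_shift, vert_iterate_shift, add_right_comm] at hi
    rw [dart_iterate_shift]
    exact h _ hi

/-- The shift of sequences. -/
def seqShift (v : ℕ → V) : ℕ → V := fun i => v (i + 1)

theorem iterate_seqShift (v : ℕ → V) (j : ℕ) : seqShift^[j] v = fun i => v (i + j) := by
  induction j generalizing v with
  | zero => rfl
  | succ j ih => exact ih (seqShift v)

theorem vert_iterate_shift_eq_seqShift (p : ClosedPath G) (j : ℕ) :
    (shift^[j] p).vert = seqShift^[j] p.vert := by
  rw [iterate_seqShift]
  exact funext (vert_iterate_shift p j)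

/-- The minimal period of the sequence of vertices of a closed path. -/
noncomputable def period (p : ClosedPath G) : ℕ := Function.minimalPeriod seqShift p.vert

theorem isPeriodicPt_vert (p : ClosedPath G) :
    Function.IsPeriodicPt seqShift p.len p.vert := by
  change seqShift^[p.len] p.vert = p.vert
  rw [iterate_seqShift]
  exact funext p.vert_add_len

theorem period_dvd_len (p : ClosedPath G) : p.period ∣ p.len :=
  p.isPeriodicPt_vert.minimalPeriod_dvd

theorem period_pos (p : ClosedPath G) : 0 < p.period :=
  p.isPeriodicPt_vert.minimalPeriod_pos p.len_pos

theorem period_le_len (p : ClosedPath G) : p.period ≤ p.len :=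
  Nat.le_of_dvd p.len_pos p.period_dvd_len

theorem period_iterate_shift (p : ClosedPath G) (j : ℕ) : (shift^[j] p).period = p.period := by
  unfold period
  rw [vert_iterate_shift_eq_seqShift]
  exact Function.minimalPeriod_apply_iterate ⟨p.len, p.len_pos, p.isPeriodicPt_vert⟩ j

theorem vert_add_period (p : ClosedPath G) (i : ℕ) : p.vert (i + p.period) = p.vert i := by
  have h : seqShift^[p.period] p.vert = p.vert := Function.iterate_minimalPeriod
  rw [iterate_seqShift] at h
  exact congrFun h i

/-- The shortest closed path of which `p` is a power. -/
noncomputable def root (p : ClosedPath G) : ClosedPath G where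
  len := p.period
  len_pos := p.period_pos
  vert := p.vert
  vert_add_len := p.vert_add_period
  adj := p.adj

theorem period_root (p : ClosedPath G) : p.root.period = p.root.len := rfl

theorem exists_root_pow_eq (p : ClosedPath G) : ∃ m : ℕ+, p.root.pow m = p := by
  obtain ⟨m, hm⟩ := p.period_dvd_len
  have hm0 : 0 < m := Nat.pos_of_mul_pos_left (hm ▸ p.len_pos)
  exact ⟨⟨m, hm0⟩, eq_of_len_eq_of_vert_eq (by rw [hm, mul_comm]; rfl) rfl⟩

/-- If the period is smaller than the length, the path is a power of its shorter root, which has the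
same vertex sequence and so stays cyclically regular. Conversely, a power of `q` has the vertex
sequence of `q`, so its period is at most the length of `q`. -/
theorem isPrime_mk_iff {p : ClosedPath G} (hp : p.IsCyclicallyRegular E) :
    (Class.mk p).IsPrime E ↔ p.period = p.len := by
  constructor
  · intro h
    by_contra hne
    obtain ⟨m, hm⟩ := p.exists_root_pow_eq
    exact h ⟨Class.mk p.root, m, isCycle_mk_iff.2 hp, lt_of_le_of_ne p.period_le_len hne,
      congrArg Class.mk hm⟩
  · rintro h ⟨c, m, -, hlt, hpow⟩
    obtain ⟨q, rfl⟩ : ∃ q, Class.mk q = c := Quot.exists_rep c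
    obtain ⟨j, rfl⟩ := mk_eq_mk_iff.1 (show Class.mk (q.pow m) = Class.mk p from hpow)
    rw [period_iterate_shift] at h
    exact absurd (h ▸ q.period_le_len : (shift^[j] (q.pow m)).len ≤ q.len) (not_le.2 hlt)

end ClosedPath

/-! ### Closed paths from prime cycles and from cyclic edge tuples -/

namespace WeightedGraph

open ClosedPath

variable {V : Type*} {X : WeightedGraph V} {E : Set X.graph.Dart}

/-- A closed path representing a prime cycle. -/
noncomputable def PrimeCycle.rep (c : X.PrimeCycle E) : ClosedPath X.graph := Quot.out c.1

theorem PrimeCycle.mk_rep (c : X.PrimeCycle E) : Class.mk c.rep = c.1 := Quot.out_eq _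

theorem PrimeCycle.isCyclicallyRegular_rep (c : X.PrimeCycle E) :
    c.rep.IsCyclicallyRegular E :=
  isCycle_mk_iff.1 (c.mk_rep ▸ c.2.1)

theorem PrimeCycle.period_rep (c : X.PrimeCycle E) : c.rep.period = c.rep.len :=
  (isPrime_mk_iff c.isCyclicallyRegular_rep).1 (c.mk_rep ▸ c.2.2)

theorem PrimeCycle.cycleTerm_eq (c : X.PrimeCycle E) (u : ℂ) :
    X.cycleTerm u c = (c.rep.weight X.weight : ℂ) * u ^ c.rep.len := by
  rw [cycleTerm, ← c.mk_rep]
  rfl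

/-- Every cyclically regular closed path is a power of a shift of the representative of a prime
cycle. -/
noncomputable def PrimeCycle.shiftPow
    (x : Σ c : X.PrimeCycle E, ℕ × Fin c.rep.len) :
    {p : ClosedPath X.graph // p.IsCyclicallyRegular E} :=
  ⟨(shift^[(x.2.2 : ℕ)] x.1.rep).pow x.2.1.succPNat, by
    have h := x.1.2.1
    rw [← x.1.mk_rep, ← mk_iterate_shift _ x.2.2] at h
    have h1 : (shift^[(x.2.2 : ℕ)] x.1.rep).IsCyclicallyRegular E := isCycle_mk_iff.1 h
    exact h1⟩

/-- The vertex sequence of a path determines its period, hence the length of the prime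
representative, its class and the shift; the total length then determines the exponent. For
surjectivity, the class of the root is the prime cycle. -/
theorem PrimeCycle.bijective_shiftPow :
    Function.Bijective (PrimeCycle.shiftPow (X := X) (E := E)) := by
  constructor
  · rintro ⟨c, m, j⟩ ⟨c', m', j'⟩ h
    have h1 : (shift^[(j : ℕ)] c.rep).pow m.succPNat = (shift^[(j' : ℕ)] c'.rep).pow m'.succPNat :=
      congrArg Subtype.val h
    have hv : (shift^[(j : ℕ)] c.rep).vert = (shift^[(j' : ℕ)] c'.rep).vert :=
      (congrArg ClosedPath.vert h1 :)
    have hlen : c.rep.len = c'.rep.len := by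
      rw [← c.period_rep, ← c'.period_rep, ← period_iterate_shift _ j,
        ← period_iterate_shift c'.rep j', period, period, hv]
    have hp : shift^[(j : ℕ)] c.rep = shift^[(j' : ℕ)] c'.rep :=
      eq_of_len_eq_of_vert_eq (by rw [len_iterate_shift, len_iterate_shift, hlen]) hv
    obtain rfl : c = c' := Subtype.ext (by
      rw [← c.mk_rep, ← c'.mk_rep, ← mk_iterate_shift _ j, hp, mk_iterate_shift])
    have hj : j = j' := by
      rw [vert_iterate_shift_eq_seqShift, vert_iterate_shift_eq_seqShift] at hv
      -- Shifts by less than the minimal period are distinct, and for a prime cycle this period is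
      -- the full length.
      exact Fin.ext (Function.iterate_injOn_Iio_minimalPeriod
        (c.period_rep.symm ▸ j.2 : (j : ℕ) < c.rep.period)
        (c.period_rep.symm ▸ j'.2 : (j' : ℕ) < c.rep.period) hv)
    subst hj
    have hm : (m + 1) * (shift^[(j : ℕ)] c.rep).len = (m' + 1) * (shift^[(j : ℕ)] c.rep).len :=
      congrArg ClosedPath.len h1
    obtain rfl : m = m' := by
      simpa using Nat.eq_of_mul_eq_mul_right (ClosedPath.len_pos _) hm
    rfl
  · rintro ⟨p, hp⟩
    have hr : p.root.IsCyclicallyRegular E := hp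
    let c : X.PrimeCycle E := ⟨Class.mk p.root, isCycle_mk_iff.2 hr,
      (isPrime_mk_iff hr).2 p.period_root⟩
    obtain ⟨j, hj⟩ := mk_eq_mk_iff.1 c.mk_rep
    obtain ⟨m, hm⟩ := p.exists_root_pow_eq
    refine ⟨⟨c, m.natPred, ⟨j % c.rep.len, Nat.mod_lt _ c.rep.len_pos⟩⟩, Subtype.ext ?_⟩
    change (shift^[j % c.rep.len] c.rep).pow m.natPred.succPNat = p
    rw [iterate_shift_mod_len, hj, PNat.succPNat_natPred, hm]

/-- A tuple of oriented edges each of which may follow its predecessor, cyclically. -/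
def IsCyclicTuple (E : Set X.graph.Dart) {k : ℕ} (f : Fin (k + 1) → X.graph.Dart) : Prop :=
  ∀ t, f (t + 1) ∈ X.next E (f t)

/-- Consecutive edges of a path always meet, and the second reverses the first exactly when the path
backtracks. Thus the rule defining the operator is the regularity condition at one turn. -/
theorem mem_next_dart_iff {p : ClosedPath X.graph} {i : ℕ} :
    p.dart (i + 1) ∈ X.next E (p.dart i) ↔ (p.vert i = p.vert (i + 2) → p.dart i ∈ E) := by
  have h : p.dart (i + 1) = (p.dart i).symm ↔ p.vert i = p.vert (i + 2) := by
    rw [SimpleGraph.Dart.ext_iff]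
    simp [ClosedPath.dart, eq_comm]
  rw [← h]
  exact ⟨fun h => h.2, fun h => ⟨rfl, h⟩⟩

theorem ofNat_add_one {k : ℕ} (i : ℕ) : Fin.ofNat (k + 1) (i + 1) = Fin.ofNat (k + 1) i + 1 := by
  ext
  simp [Fin.val_add, Nat.add_mod]

/-- The closed path running through a cyclic tuple of oriented edges. -/
def pathOfTuple
    (x : {x : Σ k : ℕ, Fin (k + 1) → X.graph.Dart // IsCyclicTuple E x.2}) :
    ClosedPath X.graph where
  len := x.1.1 + 1
  len_pos := Nat.succ_pos _
  vert i := (x.1.2 (Fin.ofNat _ i)).fst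
  vert_add_len i := by
    refine congrArg (fun t => (x.1.2 t).fst) (Fin.ext ?_)
    simp
  adj i := by
    rw [ofNat_add_one, (x.2 _).1]
    exact (x.1.2 _).adj

theorem dart_pathOfTuple
    (x : {x : Σ k : ℕ, Fin (k + 1) → X.graph.Dart // IsCyclicTuple E x.2}) (i : ℕ) :
    (pathOfTuple x).dart i = x.1.2 (Fin.ofNat _ i) := by
  refine SimpleGraph.Dart.ext _ _ (Prod.ext rfl ?_)
  change (x.1.2 (Fin.ofNat _ (i + 1))).fst = (x.1.2 (Fin.ofNat _ i)).snd
  rw [ofNat_add_one, (x.2 _).1]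

theorem isCyclicallyRegular_pathOfTuple
    (x : {x : Σ k : ℕ, Fin (k + 1) → X.graph.Dart // IsCyclicTuple E x.2}) :
    (pathOfTuple x).IsCyclicallyRegular E := by
  intro i
  rw [← mem_next_dart_iff, dart_pathOfTuple, dart_pathOfTuple, ofNat_add_one]
  exact x.2 _

theorem bijective_pathOfTuple :
    Function.Bijective fun x : {x : Σ k : ℕ, Fin (k + 1) → X.graph.Dart // IsCyclicTuple E x.2} =>
      (⟨pathOfTuple x, isCyclicallyRegular_pathOfTuple x⟩ :
        {p : ClosedPath X.graph // p.IsCyclicallyRegular E}) := by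
  constructor
  · rintro ⟨⟨k, f⟩, hf⟩ ⟨⟨k', f'⟩, hf'⟩ h
    have h1 := congrArg Subtype.val h
    obtain rfl : k = k' := Nat.succ_injective (congrArg ClosedPath.len h1)
    obtain rfl : f = f' := funext fun t => by
      have h2 := congrArg (fun p => p.dart t) h1
      simp only [dart_pathOfTuple] at h2
      simpa using h2
    rfl
  · rintro ⟨p, hp⟩
    obtain ⟨k, hk⟩ : ∃ k, p.len = k + 1 := ⟨p.len - 1, by have := p.len_pos; omega⟩
    have hmod : ∀ i, p.dart (i % (k + 1)) = p.dart i := fun i => by rw [← hk, dart_mod_len]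
    refine ⟨⟨⟨k, fun t => p.dart t⟩, fun t => ?_⟩, Subtype.ext ?_⟩
    · change p.dart ((t + 1 : Fin (k + 1)) : ℕ) ∈ X.next E (p.dart t)
      have : p.dart ((t + 1 : Fin (k + 1)) : ℕ) = p.dart (t + 1) := by
        rw [← hmod (t + 1)]
        congr 1
        simp [Fin.val_add]
      rw [this]
      exact mem_next_dart_iff.2 (hp t)
    · refine eq_of_len_eq_of_vert_eq hk.symm (vert_eq_of_dart_eq fun i => ?_)
      rw [dart_pathOfTuple]
      exact hmod i

theorem weight_pathOfTuple
    (x : {x : Σ k : ℕ, Fin (k + 1) → X.graph.Dart // IsCyclicTuple E x.2}) :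
    (pathOfTuple x).weight X.weight = ∏ t, X.weight (x.1.2 t) := by
  change ∏ i ∈ Finset.range (x.1.1 + 1), _ = _
  rw [Finset.prod_range]
  refine Finset.prod_congr rfl fun t _ => ?_
  rw [dart_pathOfTuple]
  simp

end WeightedGraph
-- Transfer matrix, trace formula and Euler product
namespace WeightedGraph

open ClosedPath

variable {V : Type*} {X : WeightedGraph V} {E : Set X.graph.Dart}

/-- The natural orthonormal basis of `ℓ²(OE)` as a Hilbert basis. -/
noncomputable def edgeBasis (X : WeightedGraph V) : HilbertBasis X.graph.Dart ℂ X.EdgeSpace :=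
  HilbertBasis.ofRepr (LinearIsometryEquiv.refl ℂ _)

theorem edgeBasis_apply (e : X.graph.Dart) : X.edgeBasis e = X.basisVec e := by
  classical
  rw [← X.edgeBasis.repr_symm_single]
  rw [basisVec]
  simp only [edgeBasis]
  congr!

theorem transferOp_edgeBasis (E : Set X.graph.Dart) (e : X.graph.Dart) :
    X.transferOp E (X.edgeBasis e) = X.transferVec E e := by
  rw [edgeBasis_apply, transferOp_basisVec, transferVec]

/-- The matrix of the transfer operator in the natural basis. -/
noncomputable def transferMatrix (X : WeightedGraph V) (E : Set X.graph.Dart) :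
    Matrix X.graph.Dart X.graph.Dart ℂ :=
  X.edgeBasis.toMatrix (X.transferOp E)

open Classical in
theorem transferMatrix_apply (e' e : X.graph.Dart) :
    X.transferMatrix E e' e = if e' ∈ X.next E e then (X.weight e' : ℂ) else 0 := by
  change inner ℂ (X.edgeBasis e') (X.transferOp E (X.edgeBasis e)) = _
  rw [transferOp_edgeBasis, edgeBasis_apply, transferVec, inner_sum]
  simp only [inner_smul_right, inner_basisVec]
  have h : ∀ a, (X.basisVec a : X.graph.Dart → ℂ) e' = if e' = a then 1 else 0 := by
    intro a
    simp [basisVec, Pi.single_apply]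
  simp [h]

theorem card_filter_next_le (X : WeightedGraph V) (E : Set X.graph.Dart) :
    ∃ M : ℕ, ∀ (F : Finset X.graph.Dart) (e' : X.graph.Dart),
      (∀ e ∈ F, e' ∈ X.next E e) → F.card ≤ M := by
  obtain ⟨M, hM⟩ := X.bounded_valency
  refine ⟨M, fun F e' hF => ?_⟩
  have hfin : (X.graph.neighborSet e'.fst).Finite :=
    Set.encard_lt_top_iff.1 (lt_of_le_of_lt (hM _) (ENat.natCast_lt_top M))
  have h1 : F.card ≤ hfin.toFinset.card := by
    refine Finset.card_le_card_of_injOn (fun e => e.fst) ?_ ?_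
    · intro e he
      have h := e.adj.symm
      rw [← (hF e he).1] at h
      simpa using h
    · intro a ha b hb hab
      exact SimpleGraph.Dart.ext _ _ (Prod.ext hab ((hF a ha).1.symm.trans (hF b hb).1))
  have h2 := hM e'.fst
  rw [hfin.encard_eq_coe_toFinset_card] at h2
  exact h1.trans (by exact_mod_cast h2)

/-- The rows of the transfer matrix are bounded by a multiple of the weights. -/
theorem sum_norm_transferMatrix_le (X : WeightedGraph V) (E : Set X.graph.Dart) :
    ∃ C : ℝ, 1 ≤ C ∧ ∀ (e' : X.graph.Dart) (F : Finset X.graph.Dart),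
      ∑ e ∈ F, ‖X.transferMatrix E e' e‖ ≤ C * X.weight e' := by
  classical
  obtain ⟨M, hM⟩ := card_filter_next_le X E
  -- `M + 1` rather than `M`, so that the constant is at least `1` and the row bound also dominates
  -- the weight itself.
  refine ⟨M + 1, by simp, fun e' F => ?_⟩
  have hw := (X.weight_pos e').le
  calc ∑ e ∈ F, ‖X.transferMatrix E e' e‖
      = ∑ e ∈ F, if e' ∈ X.next E e then X.weight e' else 0 := by
        refine Finset.sum_congr rfl fun e _ => ?_
        rw [transferMatrix_apply]
        split_ifs <;> simp [abs_of_nonneg hw]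
    _ = (F.filter fun e => e' ∈ X.next E e).card * X.weight e' := by
        rw [← Finset.sum_filter, Finset.sum_const, nsmul_eq_mul]
    _ ≤ (M + 1) * X.weight e' := by
        refine mul_le_mul_of_nonneg_right ?_ hw
        have : ((F.filter fun e => e' ∈ X.next E e).card : ℝ) ≤ M := by
          exact_mod_cast hM _ e' fun e he => (Finset.mem_filter.1 he).2
        linarith

theorem prod_transferMatrix_of_isCyclicTuple {k : ℕ} {f : Fin (k + 1) → X.graph.Dart}
    (hf : IsCyclicTuple E f) :
    ∏ t, X.transferMatrix E (f (t + 1)) (f t) = ∏ t, (X.weight (f t) : ℂ) := by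
  classical
  rw [← Equiv.prod_comp (Equiv.addRight (1 : Fin (k + 1))) fun t => (X.weight (f t) : ℂ)]
  refine Finset.prod_congr rfl fun t _ => ?_
  rw [transferMatrix_apply, if_pos (hf t)]
  rfl

theorem prod_transferMatrix_of_not_isCyclicTuple {k : ℕ} {f : Fin (k + 1) → X.graph.Dart}
    (hf : ¬ IsCyclicTuple E f) : ∏ t, X.transferMatrix E (f (t + 1)) (f t) = 0 := by
  classical
  obtain ⟨t, ht⟩ := not_forall.1 hf
  exact Finset.prod_eq_zero (Finset.mem_univ t) (by rw [transferMatrix_apply, if_neg ht])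

/-- Columns of the transfer matrix are indexed by the earlier edge, so `cyclicSum` runs through
tuples backwards. Negation on `Fin (k + 1)` reverses them. -/
theorem hasSum_prod_transferMatrix {B : X.graph.Dart → ℝ}
    (hA : ∀ a (F : Finset X.graph.Dart), ∑ e ∈ F, ‖X.transferMatrix E a e‖ ≤ B a)
    (hB : Summable B) (k : ℕ) :
    HasSum (fun f : Fin (k + 1) → X.graph.Dart => ∏ t, X.transferMatrix E (f (t + 1)) (f t))
      ((X.transferMatrix E).cyclicSum k) := by
  refine (((Equiv.neg (Fin (k + 1))).arrowCongr (Equiv.refl X.graph.Dart)).hasSum_iff.2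
    (hasSum_cyclicSum hA hB k)).congr_fun fun f => ?_
  let s : Fin (k + 1) ≃ Fin (k + 1) := (Equiv.addRight 1).trans (Equiv.neg _)
  refine (Equiv.prod_comp s _).symm.trans (Finset.prod_congr rfl fun t _ => ?_)
  change X.transferMatrix E (f (-(t + 1) + 1)) (f (-(t + 1))) =
    X.transferMatrix E (f (-t)) (f (-(t + 1)))
  rw [neg_add, neg_add_cancel_right]

theorem summable_sigma_prod_tuple {κ : Type*} {B : κ → ℝ} (hB : Summable B) (hB0 : ∀ a, 0 ≤ B a)
    {r : ℝ} (hr0 : 0 ≤ r) (hr : r * ∑' a, B a < 1) :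
    Summable fun x : Σ k : ℕ, Fin (k + 1) → κ => r ^ (x.1 + 1) * ∏ t, B (x.2 t) := by
  have h0 : ∀ x : (Σ k : ℕ, Fin (k + 1) → κ), 0 ≤ r ^ (x.1 + 1) * ∏ t, B (x.2 t) := fun x =>
    mul_nonneg (pow_nonneg hr0 _) (Finset.prod_nonneg fun t _ => hB0 _)
  have h1 : ∀ k : ℕ, HasSum (fun f : Fin (k + 1) → κ => r ^ (k + 1) * ∏ t, B (f t))
      ((r * ∑' a, B a) ^ (k + 1)) := fun k => by
    rw [mul_pow]
    exact HasSum.mul_left (f := fun f : Fin (k + 1) → κ => ∏ t, B (f t)) _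
      (hasSum_prod_tuple hB (k + 1))
  refine (summable_sigma_of_nonneg h0).2 ⟨fun k => (h1 k).summable, ?_⟩
  simp only [(h1 _).tsum_eq]
  exact (summable_nat_add_iff 1).2
    (summable_geometric_of_lt_one (mul_nonneg hr0 (tsum_nonneg hB0)) hr)

/-- Distributes a sum equally over the `n` shifts of a cycle of length `n`. -/
theorem hasSum_prod_fin_mul_inv {f : ℕ → ℂ} {a : ℂ} (h : HasSum f a) {n : ℕ} (hn : n ≠ 0) :
    HasSum (fun x : ℕ × Fin n => f x.1 * (n : ℂ)⁻¹) a := by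
  have hn' : (n : ℂ) ≠ 0 := by exact_mod_cast hn
  have h2 : HasSum (fun _ : Fin n => (n : ℂ)⁻¹) 1 := by
    convert! hasSum_fintype (fun _ : Fin n => (n : ℂ)⁻¹) using 1
    simp [hn']
  have h3 := h.mul h2 (summable_mul_of_summable_norm (f := f) (g := fun _ : Fin n => (n : ℂ)⁻¹)
    h.summable.norm h2.summable.norm)
  rwa [mul_one] at h3

/-- The contribution of a closed path to the logarithm of the zeta function. -/
noncomputable def pathTerm (X : WeightedGraph V) (u : ℂ) (p : ClosedPath X.graph) : ℂ :=
  u ^ p.len * (p.weight X.weight : ℂ) / p.len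

/-- Tuples that are not cyclic contribute `0`, and the cyclic ones correspond to the cyclically
regular closed paths. The bound by products of `B` makes the family over all lengths absolutely
summable, so it may be regrouped. -/
theorem hasSum_pathTerm {B : X.graph.Dart → ℝ}
    (hA : ∀ a (F : Finset X.graph.Dart), ∑ e ∈ F, ‖X.transferMatrix E a e‖ ≤ B a)
    (hB : Summable B) {u : ℂ} (hu : ‖u‖ * ∑' a, B a < 1) :
    HasSum (fun p : {p : ClosedPath X.graph // p.IsCyclicallyRegular E} => X.pathTerm u p)
      (∑' k : ℕ, u ^ (k + 1) * (X.transferMatrix E).cyclicSum k / (k + 1)) := by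
  set A := X.transferMatrix E with hAdef
  let θ : (Σ k : ℕ, Fin (k + 1) → X.graph.Dart) → ℂ := fun x =>
    u ^ (x.1 + 1) / (x.1 + 1) * ∏ t, A (x.2 (t + 1)) (x.2 t)
  have hβ0 : 0 ≤ ∑' a, B a := tsum_nonneg (nonneg_of_sum_norm_le hA)
  have hθ : Summable θ := by
    have hbound : ∀ x, ‖θ x‖ ≤ ‖u‖ ^ (x.1 + 1) * ∏ t, B (x.2 t) := by
      rintro ⟨k, f⟩
      have h1 : ‖((k : ℂ) + 1)‖ = k + 1 := by
        rw [← Nat.cast_succ, Complex.norm_natCast, Nat.cast_succ]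
      have h2 : ‖∏ t, A (f (t + 1)) (f t)‖ ≤ ∏ t, B (f t) := by
        rw [norm_prod, ← Equiv.prod_comp (Equiv.addRight (1 : Fin (k + 1))) fun t => B (f t)]
        exact Finset.prod_le_prod (fun _ _ => norm_nonneg _) fun t _ =>
          norm_le_of_sum_norm_le hA (f (t + 1)) (f t)
      simp only [θ, norm_mul, norm_div, norm_pow, h1]
      refine mul_le_mul (div_le_self (by positivity) ?_) h2 (norm_nonneg _) (by positivity)
      linarith [Nat.cast_nonneg (α := ℝ) k]
    exact Summable.of_norm_bounded
      (summable_sigma_prod_tuple hB (nonneg_of_sum_norm_le hA) (norm_nonneg u) hu) hbound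
  have hθ' : ∑' k : ℕ, u ^ (k + 1) * A.cyclicSum k / (k + 1) = ∑' x, θ x := by
    refine (hθ.hasSum.sigma fun k => ?_).tsum_eq
    convert! (hasSum_prod_transferMatrix hA hB k).mul_left (u ^ (k + 1) / ((k : ℂ) + 1)) using 1
    ring
  rw [hθ', ← (Equiv.ofBijective _ (bijective_pathOfTuple (X := X) (E := E))).hasSum_iff]
  refine ((hasSum_subtype_iff_of_support_subset (f := θ)
    (s := {x | IsCyclicTuple E x.2}) fun x hx => ?_).2 hθ.hasSum).congr_fun fun x => ?_
  · by_contra hne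
    exact hx (by simp only [θ, hAdef, prod_transferMatrix_of_not_isCyclicTuple hne, mul_zero])
  · have h : ∏ t, A (x.1.2 (t + 1)) (x.1.2 t) = ∏ t, (X.weight (x.1.2 t) : ℂ) :=
      prod_transferMatrix_of_isCyclicTuple x.2
    have hl : (pathOfTuple x).len = x.1.1 + 1 := rfl
    simp only [Function.comp_apply, Equiv.ofBijective_apply, pathTerm, θ, h, weight_pathOfTuple, hl]
    push_cast
    ring

theorem norm_cycleTerm_lt_one {B : X.graph.Dart → ℝ} (hwB : ∀ a, X.weight a ≤ B a)
    (hB : Summable B) {u : ℂ} (hu : ‖u‖ * ∑' a, B a < 1) (c : X.PrimeCycle E) :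
    ‖X.cycleTerm u c‖ < 1 := by
  have hB0 : ∀ a, 0 ≤ B a := fun a => (X.weight_pos a).le.trans (hwB a)
  have hw0 : 0 ≤ c.rep.weight X.weight := Finset.prod_nonneg fun i _ => (X.weight_pos _).le
  have hw : c.rep.weight X.weight ≤ (∑' a, B a) ^ c.rep.len := by
    refine (Finset.prod_le_prod (fun i _ => (X.weight_pos _).le) fun i _ =>
      (hwB _).trans (hB.le_tsum _ fun a _ => hB0 a)).trans_eq ?_
    simp
  rw [c.cycleTerm_eq, norm_mul, norm_pow, Complex.norm_real, Real.norm_of_nonneg hw0]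
  calc c.rep.weight X.weight * ‖u‖ ^ c.rep.len
      ≤ (∑' a, B a) ^ c.rep.len * ‖u‖ ^ c.rep.len :=
        mul_le_mul_of_nonneg_right hw (by positivity)
    _ = (‖u‖ * ∑' a, B a) ^ c.rep.len := by rw [← mul_pow, mul_comm]
    _ < 1 := pow_lt_one₀ (mul_nonneg (norm_nonneg u) (tsum_nonneg hB0)) hu c.rep.len_pos.ne'

theorem pathTerm_shiftPow (u : ℂ) (c : X.PrimeCycle E) (m : ℕ) (j : Fin c.rep.len) :
    X.pathTerm u (PrimeCycle.shiftPow ⟨c, m, j⟩) =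
      X.cycleTerm u c ^ (m + 1) / (m + 1) * (c.rep.len : ℂ)⁻¹ := by
  change X.pathTerm u ((shift^[(j : ℕ)] c.rep).pow m.succPNat) = _
  have hl : ((shift^[(j : ℕ)] c.rep).pow m.succPNat).len = (m + 1) * c.rep.len := by
    change (m + 1) * (shift^[(j : ℕ)] c.rep).len = _
    rw [len_iterate_shift]
  have hl0 : (c.rep.len : ℂ) ≠ 0 := by exact_mod_cast c.rep.len_pos.ne'
  rw [pathTerm, hl, weight_pow, weight_iterate_shift, c.cycleTerm_eq, Nat.succPNat_coe]
  have hm : (m : ℂ) + 1 ≠ 0 := by exact_mod_cast m.succ_ne_zero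
  push_cast
  rw [mul_pow, ← pow_mul, mul_comm c.rep.len]
  field_simp

/-- The sum over closed paths is regrouped by prime cycle; within one cycle, summing over shifts and
exponents gives the logarithm series. -/
theorem hasSum_neg_log_cycleTerm {B : X.graph.Dart → ℝ}
    (hA : ∀ a (F : Finset X.graph.Dart), ∑ e ∈ F, ‖X.transferMatrix E a e‖ ≤ B a)
    (hwB : ∀ a, X.weight a ≤ B a)
    (hB : Summable B) {u : ℂ} (hu : ‖u‖ * ∑' a, B a < 1) :
    HasSum (fun c : X.PrimeCycle E => -Complex.log (1 - X.cycleTerm u c))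
      (∑' k : ℕ, u ^ (k + 1) * (X.transferMatrix E).cyclicSum k / (k + 1)) := by
  have h1 : ∀ c : X.PrimeCycle E, HasSum (fun x : ℕ × Fin c.rep.len =>
      X.pathTerm u (PrimeCycle.shiftPow ⟨c, x⟩)) (-Complex.log (1 - X.cycleTerm u c)) := fun c => by
    have h := Complex.hasSum_taylorSeries_neg_log (norm_cycleTerm_lt_one hwB hB hu c)
    rw [← hasSum_nat_add_iff' 1] at h
    have h' : HasSum (fun m : ℕ => X.cycleTerm u c ^ (m + 1) / ((m : ℂ) + 1))
        (-Complex.log (1 - X.cycleTerm u c)) := by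
      simpa using h
    exact (hasSum_prod_fin_mul_inv h' c.rep.len_pos.ne').congr_fun fun x =>
      pathTerm_shiftPow u c x.1 x.2
  have h2 : HasSum (fun x : Σ c : X.PrimeCycle E, ℕ × Fin c.rep.len =>
      X.pathTerm u (PrimeCycle.shiftPow x))
      (∑' k : ℕ, u ^ (k + 1) * (X.transferMatrix E).cyclicSum k / (k + 1)) :=
    (Equiv.ofBijective _ (PrimeCycle.bijective_shiftPow (X := X) (E := E))).hasSum_iff.2
      (hasSum_pathTerm hA hB hu)
  exact h2.sigma h1

/-- The Euler product, for small `u`. -/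
theorem hasProd_zeta {B : X.graph.Dart → ℝ}
    (hA : ∀ a (F : Finset X.graph.Dart), ∑ e ∈ F, ‖X.transferMatrix E a e‖ ≤ B a)
    (hwB : ∀ a, X.weight a ≤ B a)
    (hB : Summable B) {u : ℂ} (hu : ‖u‖ * ∑' a, B a < 1) :
    HasProd (fun c : X.PrimeCycle E => (1 - X.cycleTerm u c)⁻¹)
      ((X.transferMatrix E).fredholmDet u)⁻¹ := by
  rw [fredholmDet_eq_exp hA hB hu, ← Complex.exp_neg, neg_neg]
  refine (hasSum_neg_log_cycleTerm hA hwB hB hu).cexp.congr_fun fun c => ?_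
  rw [Function.comp_apply, Complex.exp_neg, Complex.exp_log]
  intro h
  have := norm_cycleTerm_lt_one hwB hB hu c
  rw [← sub_eq_zero.1 h] at this
  simp at this

theorem hasFredholmDet_smul_transferOp {B : X.graph.Dart → ℝ}
    (hA : ∀ a (F : Finset X.graph.Dart), ∑ e ∈ F, ‖X.transferMatrix E a e‖ ≤ B a)
    (hB : Summable B) (u : ℂ) :
    HasFredholmDet (u • X.transferOp E) ((X.transferMatrix E).fredholmDet u) := by
  refine hasFredholmDet_of_hasSum_principalMinor X.edgeBasis ?_ ?_
  · simpa only [smul_apply, norm_smul, transferOp_edgeBasis] using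
      (X.summable_norm_transferVec E).mul_left ‖u‖
  · refine (hasSum_fredholmDet hA hB u).congr_fun fun S => ?_
    classical
    have h : X.edgeBasis.toMatrix (u • X.transferOp E) = u • X.transferMatrix E := by
      ext a e
      exact inner_smul_right (X.edgeBasis a) (X.transferOp E (X.edgeBasis e)) u
    have h2 := Matrix.det_smul ((X.transferMatrix E).submatrix ((↑) : S → X.graph.Dart)
      ((↑) : S → X.graph.Dart)) u
    rw [Fintype.card_coe] at h2
    rw [h, Matrix.principalMinor_eq, Matrix.principalMinor_eq, neg_pow u, mul_assoc, ← h2]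
    rfl

end WeightedGraph

theorem theorem5p1 {V : Type*} (X : WeightedGraph V) (E : Set X.graph.Dart) :
    -- `T_E` is of trace class
    IsTraceClass (X.transferOp E) ∧
    -- there are a radius `r > 0` and a function `F` on the complex plane such that
    ∃ r : ℝ, 0 < r ∧ ∃ F : ℂ → ℂ,
      -- for `|u| < r` the Euler product converges to `F u ≠ 0`
      (∀ u : ℂ, ‖u‖ < r →
        (∀ p : X.PrimeCycle E, 1 - X.cycleTerm u p ≠ 0) ∧
        Multipliable (fun p : X.PrimeCycle E => (1 - X.cycleTerm u p)⁻¹) ∧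
        X.zeta E u = F u ∧ F u ≠ 0) ∧
      -- `F` is meromorphic on the complex plane, without zeros
      Meromorphic F ∧ (∀ u : ℂ, meromorphicOrderAt F u ≤ 0) ∧
      -- `1 / F` is entire and equals `det (1 - u T_E)` (at a pole of `F`, Lean's `(F u)⁻¹` is `0`)
      Differentiable ℂ (fun u : ℂ => (F u)⁻¹) ∧
      ∀ u : ℂ, HasFredholmDet (u • X.transferOp E) (F u)⁻¹ := by
  obtain ⟨C, hC, hA⟩ := X.sum_norm_transferMatrix_le E
  have hB : Summable fun e => C * X.weight e := X.summable_weight.mul_left C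
  have hwB : ∀ e, X.weight e ≤ C * X.weight e := fun e =>
    le_mul_of_one_le_left (X.weight_pos e).le hC
  set β := ∑' e, C * X.weight e with hβ
  have hβ0 : 0 ≤ β := tsum_nonneg fun e => (X.weight_pos e).le.trans (hwB e)
  set D := (X.transferMatrix E).fredholmDet with hD
  have hDd : Differentiable ℂ D := differentiable_fredholmDet hA hB
  have hDan : ∀ u, AnalyticAt ℂ D u := fun u => hDd.analyticAt u
  -- The radius forces `‖u‖ * β < 1`, and `β + 1` avoids dividing by zero when there are no edges.
  -- At a zero of `D` the function `(D u)⁻¹` takes the value `0`, so its inverse is `D` everywhere.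
  refine ⟨isTraceClass_of_summable_norm X.edgeBasis ?_, 1 / (β + 1), by positivity, fun u => (D u)⁻¹,
    fun u hu => ?_, fun u => (hDan u).meromorphicAt.inv, fun u => ?_, ?_, fun u => ?_⟩
  · simpa only [X.transferOp_edgeBasis] using X.summable_norm_transferVec E
  · have hu' : ‖u‖ * β < 1 := by
      rw [lt_div_iff₀ (by positivity)] at hu
      nlinarith [norm_nonneg u]
    have hprod := X.hasProd_zeta hA hwB hB hu'
    refine ⟨fun c h => ?_, hprod.multipliable, hprod.tprod_eq, ?_⟩
    · have := X.norm_cycleTerm_lt_one hwB hB hu' c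
      rw [← sub_eq_zero.1 h] at this
      simp at this
    · change (D u)⁻¹ ≠ 0
      rw [hD, fredholmDet_eq_exp hA hB hu']
      exact inv_ne_zero (Complex.exp_ne_zero _)
  · have hmer : MeromorphicOn D Set.univ := fun u _ => (hDan u).meromorphicAt
    -- Since `D 0 = 1`, the order is finite at `0` and, as the plane is connected, everywhere. As
    -- `D` is entire its orders are nonnegative, so those of its inverse are at most `0`.
    have h0 : meromorphicOrderAt D 0 ≠ ⊤ := by
      rw [meromorphicOrderAt_ne_top_iff_eventually_ne_zero (hDan 0).meromorphicAt]
      refine ((hDan 0).continuousAt.eventually_ne ?_).filter_mono nhdsWithin_le_nhds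
      rw [hD, fredholmDet_zero]
      exact one_ne_zero
    have hne : meromorphicOrderAt D u ≠ ⊤ :=
      hmer.meromorphicOrderAt_ne_top_of_isPreconnected isPreconnected_univ (Set.mem_univ 0)
        (Set.mem_univ u) h0
    have hnn : 0 ≤ meromorphicOrderAt D u := (hDan u).meromorphicOrderAt_nonneg
    change meromorphicOrderAt D⁻¹ u ≤ 0
    rw [meromorphicOrderAt_inv]
    lift meromorphicOrderAt D u to ℤ using hne with n
    have hn : 0 ≤ n := by exact_mod_cast hnn
    change ((-n : ℤ) : WithTop ℤ) ≤ ((0 : ℤ) : WithTop ℤ)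
    exact_mod_cast neg_nonpos.2 hn
  · simpa only [inv_inv] using hDd
  · simpa only [inv_inv] using X.hasFredholmDet_smul_transferOp hA hB u
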